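/- Let $(M,g_1)$ be a Riemannian manifold, $(N,g_2,J)$ a Kähler manifold (smooth, finite-dimensional, without boundary), and let $F:M\to N$ be an anti-invariant Riemannian map: $F$ is smooth with $\operatorname{rank}F>0$ everywhere, $g_2(F_*X,F_*Y)=g_1(X,Y)$ for $X,Y\in(\ker F_*)^\perp$, and $J(\operatorname{range}F_*)\subseteq(\operatorname{range}F_*)^\perp$. Assume that $(\operatorname{range}F_*)^\perp$ is totally geodesic, i.e. there is a smooth distribution $D$ on an open set $U\supseteq F(M)$ with $D_{F(p)}=F_{*p}(T_pM)$ for all $p\in M$ and $\nabla^N_UV\in\Gamma(D^\perp)$ for all $U,V\in\Gamma(D^\perp)$. Let $g:N\to\mathbb R$ be smooth. Notation. For $W\in(\operatorname{range}F_*)^\perp$, $-\mathcal S_WF_*X$ and $\nabla^{F\perp}_XW$ are the components of $\nabla^N_{F_*X}W$ in $\operatorname{range}F_*$ and $(\operatorname{range}F_*)^\perp$; $\nabla^{F\perp}_VW$ is the $(\operatorname{range}F_*)^\perp$-component of $\nabla^N_VW$; $(\nabla F_*)(X,Y)=\nabla^F_XF_*Y-F_*(\nabla^M_XY)$ is the second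 fundamental form, with $\nabla^F$ the pullback of the Levi-Civita connection $\nabla^N$; ${}^*F_*$ is the adjoint of $F_*$; and for $V\in(\operatorname{range}F_*)^\perp$, $JV=BV+CV$ with $BV\in\operatorname{range}F_*$, $CV\in(\operatorname{range}F_*)^\perp$. Let $I\subseteq\mathbb R$ be an open interval and $\beta:I\to N$ a geodesic with $\beta(I)\subseteq F(M)$; choose points $\alpha(t)\in M$ with $\beta(t)=F(\alpha(t))$ and write $\dot\beta(t)=F_*X+V$ with $X\in(\ker F_{*\alpha(t)})^\perp$, $V\in(\operatorname{range}F_{*\alpha(t)})^\perp$. Let $\omega(t)$ be the angle between $\dot\beta(t)$ and $V(t)$ (with $\omega=\pi/2$ if $V=0$). The Clairaut relation along $\beta$ with a function $\tilde s:N\to\mathbb R^+$ says that $\tilde s(\beta(t))\sin\omega(t)$ is constant on $I$; $F$ is called Clairaut with $\tilde s$ if this holds for every such geodesic $\beta$. Consider the equation $$g_2\big(\mathcal S_{JF_*X}F_*X+\mathcal S_{CV}F_*X,\,BV\big)-g_2\big((\nabla F_*)(X,{}^*F_*BV)+\nabla^{F\perp}_XJF_*X+\nabla^{F\perp}_VJF_*X,\,CV\big)-g_2(F_*X,F_*X)\,\frac{d(g\circ\beta)}{dt}=0,\qquad(\ast)$$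 where, in $\nabla^{F\perp}_XJF_*X$ and $\nabla^{F\perp}_VJF_*X$, the field $F_*X$ along $\beta$ is replaced by an arbitrary smooth local vector field on $N$ extending it (the same in both terms; $(\ast)$ is required for every such extension). Then: (1) $F$ is Clairaut with $\tilde s=e^g$ if and only if $(\ast)$ holds at every $t\in I$ along every geodesic $\beta:I\to N$ with $\beta(I)\subseteq F(M)$ (and every choice of the points $\alpha(t)$). (2) For every geodesic $\alpha:I\to M$ such that $\beta=F\circ\alpha$ is a geodesic of $N$, the Clairaut relation with $\tilde s=e^g$ holds along $\beta$ if and only if $(\ast)$ holds at every $t\in I$. -/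

import Mathlib

open Set Filter Bundle
open scoped Manifold ContDiff Topology

noncomputable section

namespace RiemMap

/-! ### The Levi-Civita connection and its pullback along a map

Manifolds are smooth, without boundary, modelled on a finite-dimensional real vector space `E`;
a Riemannian metric is Mathlib's `RiemannianBundle` structure on the tangent bundle. -/

/-- Christoffel symbols of the first kind at `y`, of a metric `G` on an open subset of a vector
space: `c ↦ ½ (∂_a G(b, c) + ∂_b G(a, c) - ∂_c G(a, b))`. -/
def christoffelFirst {E : Type*} [NormedAddCommGroup E] [NormedSpace ℝ E]
    (G : E → E →L[ℝ] E →L[ℝ] ℝ) (y a b : E) : E →L[ℝ] ℝ :=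
  (1 / 2 : ℝ) • (fderiv ℝ G y a b + fderiv ℝ G y b a - ((fderiv ℝ G y).flip a).flip b)

section Connection

variable {E : Type*} [NormedAddCommGroup E] [NormedSpace ℝ E] [FiniteDimensional ℝ E]
  {N : Type*} [TopologicalSpace N] [ChartedSpace E N] [IsManifold 𝓘(ℝ, E) ∞ N]
  [RiemannianBundle (fun x : N ↦ TangentSpace 𝓘(ℝ, E) x)]

instance (x : N) : FiniteDimensional ℝ (TangentSpace 𝓘(ℝ, E) x) :=
  inferInstanceAs (FiniteDimensional ℝ E)

/-- The differential at `y` of the inverse of the chart `φ` centred at `x₀`. -/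
def chartSymmDeriv (x₀ : N) (y : E) :
    E →L[ℝ] TangentSpace 𝓘(ℝ, E) ((extChartAt 𝓘(ℝ, E) x₀).symm y) :=
  mfderiv 𝓘(ℝ, E) 𝓘(ℝ, E) (extChartAt 𝓘(ℝ, E) x₀).symm y

/-- The differential at `x` of the chart `φ` centred at `x₀`. -/
def chartDeriv (x₀ x : N) : TangentSpace 𝓘(ℝ, E) x →L[ℝ] E :=
  mfderiv 𝓘(ℝ, E) 𝓘(ℝ, E) (extChartAt 𝓘(ℝ, E) x₀) x

/-- The metric in the chart `φ` centred at `x₀`: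
`G y (a, b) = ⟨d(φ⁻¹)_y a, d(φ⁻¹)_y b⟩`. -/
def chartMetric (x₀ : N) (y : E) : E →L[ℝ] E →L[ℝ] ℝ :=
  (innerSL ℝ (E := TangentSpace 𝓘(ℝ, E) ((extChartAt 𝓘(ℝ, E) x₀).symm y))).bilinearComp
    (chartSymmDeriv x₀ y) (chartSymmDeriv x₀ y)

/-- The Christoffel term `Γ(v, w)` at `x₀`, in the chart centred at `x₀`, as a tangent vector: the
index of `christoffelFirst` is raised with the metric. -/
def christoffel (x₀ : N) (v w : TangentSpace 𝓘(ℝ, E) x₀) : TangentSpace 𝓘(ℝ, E) x₀ :=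
  (InnerProductSpace.toDual ℝ (TangentSpace 𝓘(ℝ, E) x₀)).symm
    ((christoffelFirst (chartMetric x₀) (extChartAt 𝓘(ℝ, E) x₀ x₀)
      (chartDeriv x₀ x₀ v) (chartDeriv x₀ x₀ w)).comp (chartDeriv x₀ x₀))

variable {E' : Type*} [NormedAddCommGroup E'] [NormedSpace ℝ E']
  {P : Type*} [TopologicalSpace P] [ChartedSpace E' P]

/-- The pullback `∇^f` along `f : P → N` of the Levi-Civita connection of `N`: the derivative
`∇^f_v Y` at `p`, in the direction `v ∈ T_p P`, of a vector field `Y` along `f`. In the chart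
centred at `f p` this is `dY^k(v) + Γ^k_{ij} (df v)^i Y^j`. -/
def covAlong (f : P → N) (Y : ∀ p : P, TangentSpace 𝓘(ℝ, E) (f p)) (p : P)
    (v : TangentSpace 𝓘(ℝ, E') p) : TangentSpace 𝓘(ℝ, E) (f p) :=
  let Ycoord : P → E := fun q ↦ chartDeriv (f p) (f q) (Y q)
  let dY : E := mfderiv 𝓘(ℝ, E') 𝓘(ℝ, E) Ycoord p v
  (chartDeriv (f p) (f p)).inverse dY
    + christoffel (f p) (mfderiv 𝓘(ℝ, E') 𝓘(ℝ, E) f p v) (Y p)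

/-- The Levi-Civita connection `∇_v Y` of `N` (at `x`, with `v ∈ T_x N`). -/
def leviCivita (Y : ∀ x : N, TangentSpace 𝓘(ℝ, E) x) (x : N) (v : TangentSpace 𝓘(ℝ, E) x) :
    TangentSpace 𝓘(ℝ, E) x :=
  covAlong (fun z : N ↦ z) Y x v

/-- The velocity `γ'(t)` of a curve. -/
def velocity (γ : ℝ → N) (t : ℝ) : TangentSpace 𝓘(ℝ, E) (γ t) :=
  mfderiv 𝓘(ℝ, ℝ) 𝓘(ℝ, E) γ t (1 : ℝ)

/-- `γ` is a (smooth) geodesic on the open set `I ⊆ ℝ`: `∇_{γ'} γ' = 0`. -/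
def IsGeodesicOn (γ : ℝ → N) (I : Set ℝ) : Prop :=
  ContMDiffOn 𝓘(ℝ, ℝ) 𝓘(ℝ, E) ∞ γ I ∧
    ∀ t ∈ I, covAlong γ (velocity (E := E) γ) t (1 : ℝ) = 0

/-- `Y` is a smooth vector field near `x`. -/
def SmoothFieldAt (Y : ∀ x : N, TangentSpace 𝓘(ℝ, E) x) (x : N) : Prop :=
  ContMDiffAt 𝓘(ℝ, E) (𝓘(ℝ, E).prod 𝓘(ℝ, E)) ∞
    (fun z ↦ (⟨z, Y z⟩ : TangentBundle 𝓘(ℝ, E) N)) x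

/-- `(N, J)` is a Kähler manifold: `J` is a smooth almost complex structure, compatible with the
metric, with `∇J = 0`. -/
structure IsKaehler (J : ∀ y : N, TangentSpace 𝓘(ℝ, E) y →L[ℝ] TangentSpace 𝓘(ℝ, E) y) :
    Prop where
  smooth : ContMDiff 𝓘(ℝ, E) (𝓘(ℝ, E).prod 𝓘(ℝ, E →L[ℝ] E)) ∞
    (fun y ↦ TotalSpace.mk' (E →L[ℝ] E)
      (E := fun y : N ↦ TangentSpace 𝓘(ℝ, E) y →L[ℝ] TangentSpace 𝓘(ℝ, E) y) y (J y))
  sq_eq_neg : ∀ (y : N) (v : TangentSpace 𝓘(ℝ, E) y), J y (J y v) = -v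
  isometry : ∀ (y : N) (v w : TangentSpace 𝓘(ℝ, E) y), inner ℝ (J y v) (J y w) = inner ℝ v w
  parallel : ∀ (Y : ∀ x : N, TangentSpace 𝓘(ℝ, E) x) (y : N) (v : TangentSpace 𝓘(ℝ, E) y),
    SmoothFieldAt Y y → leviCivita (fun z ↦ J z (Y z)) y v = J y (leviCivita Y y v)

end Connection

/-! ### Riemannian maps -/

section Map

variable {E₁ : Type*} [NormedAddCommGroup E₁] [NormedSpace ℝ E₁] [FiniteDimensional ℝ E₁]
  {M : Type*} [TopologicalSpace M] [ChartedSpace E₁ M] [IsManifold 𝓘(ℝ, E₁) ∞ M]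
  [RiemannianBundle (fun x : M ↦ TangentSpace 𝓘(ℝ, E₁) x)]
  {E₂ : Type*} [NormedAddCommGroup E₂] [NormedSpace ℝ E₂] [FiniteDimensional ℝ E₂]
  {N : Type*} [TopologicalSpace N] [ChartedSpace E₂ N] [IsManifold 𝓘(ℝ, E₂) ∞ N]
  [RiemannianBundle (fun x : N ↦ TangentSpace 𝓘(ℝ, E₂) x)]

/-- The differential `F_*` at `p`. -/
def push (F : M → N) (p : M) : TangentSpace 𝓘(ℝ, E₁) p →L[ℝ] TangentSpace 𝓘(ℝ, E₂) (F p) :=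
  mfderiv 𝓘(ℝ, E₁) 𝓘(ℝ, E₂) F p

/-- `ker F_*` at `p`, a subspace of `T_p M`. -/
def kerAt (F : M → N) (p : M) : Submodule ℝ (TangentSpace 𝓘(ℝ, E₁) p) :=
  LinearMap.ker (push (E₁ := E₁) (E₂ := E₂) F p).toLinearMap

/-- `range F_*` at `p`, a subspace of `T_{F p} N`. -/
def rangeAt (F : M → N) (p : M) : Submodule ℝ (TangentSpace 𝓘(ℝ, E₂) (F p)) :=
  LinearMap.range (push (E₁ := E₁) (E₂ := E₂) F p).toLinearMap

/-- `F` is a Riemannian map: smooth, nowhere of rank zero, and `F_*` restricted to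
`(ker F_*)ᗮ` preserves inner products. -/
structure IsRiemannianMap (F : M → N) : Prop where
  smooth : ContMDiff 𝓘(ℝ, E₁) 𝓘(ℝ, E₂) ∞ F
  rank_pos : ∀ p : M, 0 < Module.finrank ℝ (rangeAt (E₁ := E₁) (E₂ := E₂) F p)
  isometry : ∀ (p : M), ∀ X ∈ (kerAt (E₁ := E₁) (E₂ := E₂) F p)ᗮ,
    ∀ Y ∈ (kerAt (E₁ := E₁) (E₂ := E₂) F p)ᗮ,
      inner ℝ (push (E₂ := E₂) F p X) (push (E₂ := E₂) F p Y) = inner ℝ X Y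

/-- `F` is anti-invariant: `J (range F_*) ⊆ (range F_*)ᗮ`. -/
def IsAntiInvariant (F : M → N)
    (J : ∀ y : N, TangentSpace 𝓘(ℝ, E₂) y →L[ℝ] TangentSpace 𝓘(ℝ, E₂) y) : Prop :=
  ∀ p : M, ∀ w ∈ rangeAt (E₁ := E₁) (E₂ := E₂) F p,
    J (F p) w ∈ (rangeAt (E₁ := E₁) (E₂ := E₂) F p)ᗮ

/-- The component in `range F_*` of a vector of `T_{F p} N`. -/
def tangPart (F : M → N) (p : M) :
    TangentSpace 𝓘(ℝ, E₂) (F p) →L[ℝ] TangentSpace 𝓘(ℝ, E₂) (F p) :=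
  (rangeAt (E₁ := E₁) (E₂ := E₂) F p).starProjection

/-- The component in `(range F_*)ᗮ` of a vector of `T_{F p} N`. -/
def normPart (F : M → N) (p : M) :
    TangentSpace 𝓘(ℝ, E₂) (F p) →L[ℝ] TangentSpace 𝓘(ℝ, E₂) (F p) :=
  (rangeAt (E₁ := E₁) (E₂ := E₂) F p)ᗮ.starProjection

/-- The standing assumption that `(range F_*)ᗮ` is totally geodesic. For this to make sense
`range F_*` has to be a distribution on the target: `D` is a smooth distribution on an open set `U`
containing the image of `F`, which at `F p` is the range of `F_*` at `p`; and `∇_u V` is a section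
of `Dᗮ` for all sections `u`, `V` of `Dᗮ`. Smoothness of `D` is expressed as smoothness of the
orthogonal projection onto it. -/
def HasTotallyGeodesicNormal (F : M → N) : Prop :=
  ∃ (U : Set N) (D : ∀ y : N, Submodule ℝ (TangentSpace 𝓘(ℝ, E₂) y)),
    IsOpen U ∧
    (∀ p : M, F p ∈ U ∧ D (F p) = rangeAt (E₁ := E₁) (E₂ := E₂) F p) ∧
    (∀ (Y : ∀ y : N, TangentSpace 𝓘(ℝ, E₂) y), ∀ y ∈ U,
      SmoothFieldAt Y y → SmoothFieldAt (fun z ↦ (D z).starProjection (Y z)) y) ∧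
    (∀ y ∈ U, ∀ u ∈ (D y)ᗮ, ∀ V : ∀ y : N, TangentSpace 𝓘(ℝ, E₂) y,
      SmoothFieldAt V y → (∀ᶠ z in 𝓝 y, V z ∈ (D z)ᗮ) → leviCivita V y u ∈ (D y)ᗮ)

/-- `S_W (F_* X)` at `p`, for `W ∈ (range F_*)ᗮ` and `X ∈ T_p M`: minus the component in
`range F_*` of `∇^F_X W`, where `W` is extended to a local section of `(range F_*)ᗮ` along `F`. -/
def shapeOp (F : M → N) (p : M) (W : TangentSpace 𝓘(ℝ, E₂) (F p))
    (X : TangentSpace 𝓘(ℝ, E₁) p) : TangentSpace 𝓘(ℝ, E₂) (F p) :=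
  -tangPart (E₁ := E₁) F p
    (covAlong F (fun q ↦ normPart (E₁ := E₁) F q (FiberBundle.extend E₂ W (F q))) p X)

/-- The second fundamental form `(∇F_*)(X, Y) = ∇^F_X (F_* Y) - F_* (∇^M_X Y)` at `p`, where `Y` is
extended to a local vector field on `M`. -/
def secondFF (F : M → N) (p : M) (X Y : TangentSpace 𝓘(ℝ, E₁) p) :
    TangentSpace 𝓘(ℝ, E₂) (F p) :=
  covAlong F (fun q ↦ push (E₁ := E₁) F q (FiberBundle.extend E₁ Y q)) p X
    - push F p (leviCivita (FiberBundle.extend E₁ Y) p X)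

/-- The normal connection `∇^{F⊥}_w W` at `F p`, for a vector `w ∈ T_{F p} N` and a vector
field `W` on `N`: the component in `(range F_*)ᗮ` of `∇^N_w W`. -/
def normCov (F : M → N) (p : M) (W : ∀ y : N, TangentSpace 𝓘(ℝ, E₂) y)
    (w : TangentSpace 𝓘(ℝ, E₂) (F p)) : TangentSpace 𝓘(ℝ, E₂) (F p) :=
  normPart (E₁ := E₁) F p (leviCivita W (F p) w)

/-- Let `α : I → M` be such that `β = F ∘ α` is a curve in `N`. The Clairaut relation along `β`:
`s(β(t)) sin ω(t)` is constant on `I`, where `ω(t)` is the angle between `β'(t)` and its component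
in `(range F_*)ᗮ` (equal to `π / 2` if that component is zero). -/
def ClairautRelation (F : M → N) (s : N → ℝ) (α : ℝ → M) (I : Set ℝ) : Prop :=
  ∀ t₁ ∈ I, ∀ t₂ ∈ I,
    s (F (α t₁)) * Real.sin (InnerProductGeometry.angle (velocity (E := E₂) (F ∘ α) t₁)
        (normPart (E₁ := E₁) F (α t₁) (velocity (E := E₂) (F ∘ α) t₁))) =
    s (F (α t₂)) * Real.sin (InnerProductGeometry.angle (velocity (E := E₂) (F ∘ α) t₂)
        (normPart (E₁ := E₁) F (α t₂) (velocity (E := E₂) (F ∘ α) t₂)))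

/-- `F` is a Clairaut map with the positive function `s`: the Clairaut relation holds along every
geodesic `β : I → N` along which `range F_*` is defined, i.e. whose image lies in the image of `F`.
Here `α t` is any choice of a point with `F (α t) = β t`; no regularity of `α` is required. -/
def IsClairaut (F : M → N) (s : N → ℝ) : Prop :=
  (∀ y, 0 < s y) ∧
  ∀ (I : Set ℝ) (α : ℝ → M), IsOpen I → IsPreconnected I →
    IsGeodesicOn (E := E₂) (F ∘ α) I → ClairautRelation (E₁ := E₁) (E₂ := E₂) F s α I

/-- The equation at time `t`
`g₂(S_{J F_* X} F_* X + S_{C V} F_* X, B V) - g₂((∇F_*)(X, *F_* B V) + ∇^{F⊥}_X J F_* X`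
`+ ∇^{F⊥}_V J F_* X, C V) - g₂(F_* X, F_* X) d(g ∘ β)/dt = 0`
along `β = F ∘ α`, where `β'(t) = F_* X + V` with `X ∈ (ker F_*)ᗮ` and `V ∈ (range F_*)ᗮ`,
`B V` and `C V` are the components of `J V` in `range F_*` and `(range F_*)ᗮ`, `*F_*` is the adjoint
of `F_*`, and `Z` is any smooth local vector field on `N` extending the field `F_* X` along `β`
(needed for the directional derivatives `∇^{F⊥}_X` and `∇^{F⊥}_V` of `J F_* X`). -/
def ClairautEquationAt (F : M → N)
    (J : ∀ y : N, TangentSpace 𝓘(ℝ, E₂) y →L[ℝ] TangentSpace 𝓘(ℝ, E₂) y)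
    (g : N → ℝ) (α : ℝ → M) (t : ℝ) : Prop :=
  let p : M := α t
  ∀ (X : TangentSpace 𝓘(ℝ, E₁) p) (V : TangentSpace 𝓘(ℝ, E₂) (F p))
    (Z : ∀ y : N, TangentSpace 𝓘(ℝ, E₂) y),
    X ∈ (kerAt (E₁ := E₁) (E₂ := E₂) F p)ᗮ → V ∈ (rangeAt (E₁ := E₁) (E₂ := E₂) F p)ᗮ →
    velocity (E := E₂) (F ∘ α) t = push F p X + V →
    SmoothFieldAt Z (F p) →
    (∀ᶠ τ in 𝓝 t, Z (F (α τ)) =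
      tangPart (E₁ := E₁) F (α τ) (velocity (E := E₂) (F ∘ α) τ)) →
    let FX := push F p X
    let BV := tangPart (E₁ := E₁) F p (J (F p) V)
    let CV := normPart (E₁ := E₁) F p (J (F p) V)
    let JFX : ∀ y : N, TangentSpace 𝓘(ℝ, E₂) y := fun y ↦ J y (Z y)
    inner ℝ (shapeOp F p (J (F p) FX) X + shapeOp F p CV X) BV
      - inner ℝ (secondFF F p X (ContinuousLinearMap.adjoint (push F p) BV)
          + normCov (E₁ := E₁) F p JFX FX + normCov (E₁ := E₁) F p JFX V) CV
      - inner ℝ FX FX * deriv (fun τ ↦ g (F (α τ))) t = 0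

end Map

end RiemMap

end

/-! Write T = F_*X for the component of β' in `range F_*`, and ∇ for the covariant derivative along
β. A geodesic has constant speed. If β' vanishes identically, both the Clairaut relation and (∗) are
trivial. Otherwise β' vanishes nowhere and sin ω = |T|/|β'|, so the relation says that e^{2g}|T|² is
constant, i.e. ⟨∇T, T⟩ + |T|² (g∘β)' = 0 (`clairautRelation_iff`).

It remains to see that the terms of (∗) without g add up to -⟨∇T, T⟩, for every extension Z of T
(`clairaut_expression_eq`). By Weingarten's equation, the S_{CV} term and the second fundamental
form term cancel (`inner_shapeOp_eq_inner_secondFF`). The operator S_{JT} differentiates only in the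
direction F_*X, but as the normal distribution is totally geodesic, the direction V adds nothing in
`range F_*`. So ⟨S_{JT}F_*X, BV⟩ = -⟨∇_{β'}JZ, BV⟩ (`inner_shapeOp_velTang`), while the two normal
connection terms give -⟨∇_{β'}JZ, CV⟩. The sum is -⟨∇_{β'}JZ, JV⟩ = -⟨∇T, V⟩, because J is parallel
and isometric. Finally, differentiating ⟨T, T⟩ = ⟨T, β'⟩ along the geodesic gives 2⟨∇T, T⟩ = ⟨∇T,
β'⟩, hence ⟨∇T, V⟩ = ⟨∇T, T⟩ (`inner_covAlong_velTang`).

No regularity of α is needed: T is the projection of β' to the distribution D, which lives on N. -/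

set_option linter.unusedSectionVars false

namespace RiemMap

/-! ### Metric compatibility of the pulled-back Levi-Civita connection, in charts. -/

section Connection

/-- A family of linear maps on a finite-dimensional space is differentiable if its values are. -/
lemma differentiableAt_clm_of_apply {D E F : Type*} [NormedAddCommGroup D] [NormedSpace ℝ D]
    [NormedAddCommGroup E] [NormedSpace ℝ E] [FiniteDimensional ℝ E] [NormedAddCommGroup F]
    [NormedSpace ℝ F] {f : D → E →L[ℝ] F} {x : D}
    (h : ∀ v, DifferentiableAt ℝ (fun y ↦ f y v) x) : DifferentiableAt ℝ f x := by
  let e₁ := ContinuousLinearEquiv.ofFinrankEq (Module.finrank_fin_fun ℝ (n := Module.finrank ℝ E)).symm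
  let e₂ := (e₁.arrowCongr (1 : F ≃L[ℝ] F)).trans
    (ContinuousLinearEquiv.piRing (Fin (Module.finrank ℝ E)))
  rw [← Function.id_comp f, ← e₂.symm_comp_self]
  exact e₂.symm.differentiable.differentiableAt.comp x (differentiableAt_pi.2 fun i ↦ h _)

/-- The product rule for a metric evaluated on two moving vectors; in a chart, this is the inner
product of two fields along a map. -/
lemma exists_hasFDerivAt_bilin {E : Type*} [NormedAddCommGroup E] [NormedSpace ℝ E]
    {G : E → E →L[ℝ] E →L[ℝ] ℝ} {y : E} (hG : DifferentiableAt ℝ G y) (a b : E) :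
    ∃ L : E × E × E →L[ℝ] ℝ, HasFDerivAt (fun z : E × E × E ↦ G z.1 z.2.1 z.2.2) L (y, a, b) ∧
      ∀ v a' b' : E, L (v, a', b') = fderiv ℝ G y v a b + G y a' b + G y a b' := by
  have h0 : HasFDerivAt (Prod.fst : E × E × E → E) (ContinuousLinearMap.fst ℝ E (E × E))
    (y, a, b) := hasFDerivAt_fst
  have h1 := HasFDerivAt.comp (g := G) (y, a, b) hG.hasFDerivAt h0
  have h2 := (h1.clm_apply hasFDerivAt_snd.fst).clm_apply hasFDerivAt_snd.snd
  refine ⟨_, h2, fun v a' b' ↦ ?_⟩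
  simp
  ring

set_option synthInstance.maxHeartbeats 200000 in
lemma christoffelFirst_add_left {E : Type*} [NormedAddCommGroup E] [NormedSpace ℝ E]
    (G : E → E →L[ℝ] E →L[ℝ] ℝ) (y a b c : E) :
    christoffelFirst G y (a + b) c = christoffelFirst G y a c + christoffelFirst G y b c := by
  ext d
  simp only [christoffelFirst, map_add, smul_apply, add_apply, sub_apply,
    ContinuousLinearMap.flip_apply, smul_eq_mul]
  ring

variable {E : Type*} [NormedAddCommGroup E] [NormedSpace ℝ E] [FiniteDimensional ℝ E]
  {N : Type*} [TopologicalSpace N] [ChartedSpace E N] [IsManifold 𝓘(ℝ, E) ∞ N]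
  {E' : Type*} [NormedAddCommGroup E'] [NormedSpace ℝ E']
  {P : Type*} [TopologicalSpace P] [ChartedSpace E' P]

/-- `Y` is a vector field along `f`, differentiable at `p`. -/
noncomputable def DiffAlong (f : P → N) (Y : ∀ p : P, TangentSpace 𝓘(ℝ, E) (f p)) (p : P) : Prop :=
  MDifferentiableAt 𝓘(ℝ, E') (𝓘(ℝ, E).prod 𝓘(ℝ, E))
    (fun q ↦ (⟨f q, Y q⟩ : TangentBundle 𝓘(ℝ, E) N)) p

/-- The coordinates of a field along `f` in the chart centred at `x`. -/
noncomputable def coordAlong (x : N) (f : P → N) (Y : ∀ p : P, TangentSpace 𝓘(ℝ, E) (f p)) (q : P) : E :=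
  chartDeriv x (f q) (Y q)

lemma chartDeriv_self (x : N) : chartDeriv x x = ContinuousLinearMap.id ℝ E :=
  mfderiv_extChartAt_self (I := 𝓘(ℝ, E)) (x := x)

lemma chartDeriv_self_inverse (x : N) (v : E) : (chartDeriv x x).inverse v = v := by
  rw [chartDeriv_self]
  exact DFunLike.congr_fun (ContinuousLinearMap.inverse_id (R := ℝ) (M := E)) v

/-- Links the chart coordinates used in `covAlong` to the trivialization in which differentiability
of sections is tested. -/
lemma chartDeriv_eq_trivialization {x y : N} (hy : y ∈ (chartAt E x).source)
    (v : TangentSpace 𝓘(ℝ, E) y) :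
    chartDeriv x y v = (trivializationAt E (TangentSpace 𝓘(ℝ, E)) x ⟨y, v⟩).2 := by
  unfold chartDeriv
  rw [← TangentBundle.continuousLinearMapAt_trivializationAt hy]
  rw [Trivialization.continuousLinearMapAt_apply, Trivialization.linearMapAt_apply, if_pos]
  simpa using hy

lemma chartSymmDeriv_eq_symmL {x : N} {y : E} (hy : y ∈ (extChartAt 𝓘(ℝ, E) x).target) (v : E) :
    chartSymmDeriv x y v = (trivializationAt E (TangentSpace 𝓘(ℝ, E)) x).symmL ℝ
      ((extChartAt 𝓘(ℝ, E) x).symm y) v := by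
  have h := (extChartAt 𝓘(ℝ, E) x).map_target hy
  rw [extChartAt_source] at h
  rw [TangentBundle.symmL_trivializationAt h, (extChartAt 𝓘(ℝ, E) x).right_inv hy]
  simp [chartSymmDeriv]

/-- An equality in the total space, since the two vectors lie over base points that are equal only
propositionally. -/
lemma chartSymmDeriv_chartDeriv {x y : N} (hy : y ∈ (chartAt E x).source)
    (v : TangentSpace 𝓘(ℝ, E) y) :
    (⟨(extChartAt 𝓘(ℝ, E) x).symm (extChartAt 𝓘(ℝ, E) x y),
      chartSymmDeriv x (extChartAt 𝓘(ℝ, E) x y) (chartDeriv x y v)⟩ : TangentBundle 𝓘(ℝ, E) N)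
      = ⟨y, v⟩ := by
  have hy' : y ∈ (extChartAt 𝓘(ℝ, E) x).source := by rwa [extChartAt_source]
  rw [chartSymmDeriv_eq_symmL ((extChartAt 𝓘(ℝ, E) x).map_source hy'),
    (extChartAt 𝓘(ℝ, E) x).left_inv hy']
  congr 1
  unfold chartDeriv
  rw [← TangentBundle.continuousLinearMapAt_trivializationAt hy]
  exact Trivialization.symmL_continuousLinearMapAt _ (by simpa using hy) v

lemma DiffAlong.mdifferentiableAt {f : P → N} {Y : ∀ p : P, TangentSpace 𝓘(ℝ, E) (f p)} {p : P}
    (hY : DiffAlong (E' := E') f Y p) : MDifferentiableAt 𝓘(ℝ, E') 𝓘(ℝ, E) f p :=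
  ((mdifferentiableAt_totalSpace _ _).1 hY).1

lemma eventually_mem_chartSource {f : P → N} {p : P} (hf : ContinuousAt f p) :
    ∀ᶠ q in 𝓝 p, f q ∈ (chartAt E (f p)).source :=
  hf.preimage_mem_nhds ((chartAt E (f p)).open_source.mem_nhds (mem_chart_source E (f p)))

lemma DiffAlong.coord {f : P → N} {Y : ∀ p : P, TangentSpace 𝓘(ℝ, E) (f p)} {p : P}
    (hY : DiffAlong (E' := E') f Y p) :
    MDifferentiableAt 𝓘(ℝ, E') 𝓘(ℝ, E) (coordAlong (f p) f Y) p := by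
  refine ((mdifferentiableAt_totalSpace _ _).1 hY).2.congr_of_eventuallyEq ?_
  filter_upwards [eventually_mem_chartSource (E := E) hY.mdifferentiableAt.continuousAt] with q hq
  exact chartDeriv_eq_trivialization hq _

variable [RiemannianBundle (fun x : N ↦ TangentSpace 𝓘(ℝ, E) x)]

lemma chartMetric_apply (x : N) (y a b : E) :
    chartMetric x y a b = inner ℝ (chartSymmDeriv x y a) (chartSymmDeriv x y b) := rfl

lemma chartMetric_coord {x y : N} (hy : y ∈ (chartAt E x).source)
    (v w : TangentSpace 𝓘(ℝ, E) y) :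
    chartMetric x (extChartAt 𝓘(ℝ, E) x y) (chartDeriv x y v) (chartDeriv x y w)
      = inner ℝ v w := by
  rw [chartMetric_apply]
  have h1 := chartSymmDeriv_chartDeriv hy v
  have h2 := chartSymmDeriv_chartDeriv hy w
  have key : ∀ (z : N) (hz : z = y) (v' w' : TangentSpace 𝓘(ℝ, E) z),
      (⟨z, v'⟩ : TangentBundle 𝓘(ℝ, E) N) = ⟨y, v⟩ →
      (⟨z, w'⟩ : TangentBundle 𝓘(ℝ, E) N) = ⟨y, w⟩ → inner ℝ v' w' = inner ℝ v w := by
    intro z hz v' w' hv hw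
    subst hz
    cases hv
    cases hw
    rfl
  exact key _ (congrArg TotalSpace.proj h1) _ _ h1 h2

lemma chartMetric_symm (x : N) (y a b : E) : chartMetric x y a b = chartMetric x y b a := by
  rw [chartMetric_apply, chartMetric_apply, real_inner_comm]

lemma inner_christoffel (x : N) (v w u : TangentSpace 𝓘(ℝ, E) x) :
    inner ℝ (christoffel x v w) u =
      christoffelFirst (chartMetric x) (extChartAt 𝓘(ℝ, E) x x) v w u := by
  unfold christoffel
  rw [InnerProductSpace.toDual_symm_apply]
  simp only [chartDeriv_self]
  rfl

/-- The derivative of the coordinates, in the chart centred at `f p`, of a field along `f`. -/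
noncomputable def coordDeriv (f : P → N) (Y : ∀ p : P, TangentSpace 𝓘(ℝ, E) (f p)) (p : P) :
    TangentSpace 𝓘(ℝ, E') p →L[ℝ] TangentSpace 𝓘(ℝ, E) (f p) :=
  mfderiv 𝓘(ℝ, E') 𝓘(ℝ, E) (coordAlong (f p) f Y) p

lemma covAlong_eq (f : P → N) (Y : ∀ p : P, TangentSpace 𝓘(ℝ, E) (f p)) (p : P)
    (v : TangentSpace 𝓘(ℝ, E') p) :
    covAlong f Y p v = coordDeriv f Y p v +
      christoffel (f p) (mfderiv 𝓘(ℝ, E') 𝓘(ℝ, E) f p v) (Y p) :=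
  congrArg (· + christoffel (f p) (mfderiv 𝓘(ℝ, E') 𝓘(ℝ, E) f p v) (Y p))
    (chartDeriv_self_inverse (f p) _)

variable [IsContMDiffRiemannianBundle 𝓘(ℝ, E) ∞ E (fun x : N ↦ TangentSpace 𝓘(ℝ, E) x)]

lemma DiffAlong.inner {f : P → N} {Y Z : ∀ p : P, TangentSpace 𝓘(ℝ, E) (f p)} {p : P}
    (hY : DiffAlong (E' := E') f Y p) (hZ : DiffAlong (E' := E') f Z p) :
    MDifferentiableAt 𝓘(ℝ, E') 𝓘(ℝ, ℝ) (fun q ↦ inner ℝ (Y q) (Z q)) p :=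
  MDifferentiableAt.inner_bundle (F := E) (E := fun x : N ↦ TangentSpace 𝓘(ℝ, E) x)
      (b := f) hY hZ

/-- The matrix entries are inner products of coordinate frame fields along the inverse chart. Those
fields are constant in the trivialization at `x`, hence differentiable. -/
lemma differentiableAt_chartMetric (x : N) :
    DifferentiableAt ℝ (chartMetric x) (extChartAt 𝓘(ℝ, E) x x) := by
  have key : ∀ a b : E, DifferentiableAt ℝ (fun y ↦ chartMetric x y a b)
      (extChartAt 𝓘(ℝ, E) x x) := by
    intro a b
    have hs : MDifferentiableAt 𝓘(ℝ, E) 𝓘(ℝ, E) (extChartAt 𝓘(ℝ, E) x).symm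
        (extChartAt 𝓘(ℝ, E) x x) :=
      ((contMDiffOn_extChartAt_symm (n := ∞) x).contMDiffAt
        (extChartAt_target_mem_nhds x)).mdifferentiableAt (by simp)
    have hx : (extChartAt 𝓘(ℝ, E) x).symm (extChartAt 𝓘(ℝ, E) x x) = x :=
      extChartAt_to_inv x
    have hv : ∀ a : E, DiffAlong (E' := E) (extChartAt 𝓘(ℝ, E) x).symm
        (fun y ↦ chartSymmDeriv x y a) (extChartAt 𝓘(ℝ, E) x x) := by
      intro a
      rw [DiffAlong, mdifferentiableAt_totalSpace]
      refine ⟨hs, ?_⟩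
      refine (mdifferentiableAt_const (c := a)).congr_of_eventuallyEq ?_
      filter_upwards [extChartAt_target_mem_nhds (I := 𝓘(ℝ, E)) x] with y hy
      rw [chartSymmDeriv_eq_symmL hy]
      simp only [hx]
      have h := (extChartAt 𝓘(ℝ, E) x).map_target hy
      rw [extChartAt_source] at h
      rw [← Trivialization.continuousLinearMapAt_apply_of_mem (R := ℝ)]
      · exact Trivialization.continuousLinearMapAt_symmL _ (by simpa using h) a
      · simpa using h
    exact (DiffAlong.inner (hv a) (hv b)).differentiableAt
  exact differentiableAt_clm_of_apply fun a ↦ differentiableAt_clm_of_apply fun b ↦ key a b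

/-- This is ∇G = 0 in coordinates: when the last two slots are symmetrised, the derivatives in the
directions `a` and `b` cancel by symmetry of G, and the two halves of the derivative along `v`
remain. -/
lemma christoffelFirst_add (x : N) (v a b : E) :
    christoffelFirst (chartMetric x) (extChartAt 𝓘(ℝ, E) x x) v a b +
      christoffelFirst (chartMetric x) (extChartAt 𝓘(ℝ, E) x x) v b a =
      fderiv ℝ (chartMetric x) (extChartAt 𝓘(ℝ, E) x x) v a b := by
  have happ : ∀ c a b : E, fderiv ℝ (chartMetric x) (extChartAt 𝓘(ℝ, E) x x) c a b =
      fderiv ℝ (fun y ↦ chartMetric x y a b) (extChartAt 𝓘(ℝ, E) x x) c := by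
    intro c a b
    have h := (((differentiableAt_chartMetric x).hasFDerivAt.clm_apply
      (hasFDerivAt_const a _)).clm_apply (hasFDerivAt_const b _)).fderiv
    rw [h]
    simp
  have hsymm : ∀ c a b : E, fderiv ℝ (chartMetric x) (extChartAt 𝓘(ℝ, E) x x) c a b =
      fderiv ℝ (chartMetric x) (extChartAt 𝓘(ℝ, E) x x) c b a := by
    intro c a b
    rw [happ, happ]
    simp only [chartMetric_symm x _ a b]
  simp only [christoffelFirst, smul_apply, add_apply, sub_apply, ContinuousLinearMap.flip_apply, smul_eq_mul]
  rw [hsymm a v b, hsymm b v a, hsymm v b a]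
  ring

/-- The pullback of the Levi-Civita connection is compatible with the metric. -/
theorem mfderiv_inner_along {f : P → N} {Y Z : ∀ p : P, TangentSpace 𝓘(ℝ, E) (f p)} {p : P}
    (hY : DiffAlong (E' := E') f Y p) (hZ : DiffAlong (E' := E') f Z p)
    (v : TangentSpace 𝓘(ℝ, E') p) :
    (mfderiv 𝓘(ℝ, E') 𝓘(ℝ, ℝ) (fun q ↦ inner ℝ (Y q) (Z q)) p v : ℝ) =
      inner ℝ (covAlong f Y p v) (Z p) + inner ℝ (Y p) (covAlong f Z p v) := by
  have hf := hY.mdifferentiableAt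
  have hcongr : (fun q ↦ inner ℝ (Y q) (Z q)) =ᶠ[𝓝 p] fun q ↦
      chartMetric (f p) (extChartAt 𝓘(ℝ, E) (f p) (f q)) (coordAlong (f p) f Y q)
        (coordAlong (f p) f Z q) := by
    filter_upwards [eventually_mem_chartSource (E := E) hf.continuousAt] with q hq
    exact (chartMetric_coord hq _ _).symm
  have hφ : HasMFDerivAt 𝓘(ℝ, E') 𝓘(ℝ, E) (fun q ↦ extChartAt 𝓘(ℝ, E) (f p) (f q)) p
      (mfderiv 𝓘(ℝ, E') 𝓘(ℝ, E) f p) := by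
    have h := (mdifferentiableAt_extChartAt (I := 𝓘(ℝ, E))
      (mem_chart_source E (f p))).hasMFDerivAt.comp p hf.hasMFDerivAt
    rw [mfderiv_extChartAt_self] at h
    exact h
  obtain ⟨L, hΦ, hL⟩ := exists_hasFDerivAt_bilin (differentiableAt_chartMetric (E := E) (f p))
    (coordAlong (f p) f Y p) (coordAlong (f p) f Z p)
  have hprod : HasMFDerivAt 𝓘(ℝ, E') 𝓘(ℝ, E × E × E) (fun q ↦
      (extChartAt 𝓘(ℝ, E) (f p) (f q), coordAlong (f p) f Y q, coordAlong (f p) f Z q)) p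
      ((mfderiv 𝓘(ℝ, E') 𝓘(ℝ, E) f p).prod ((coordDeriv f Y p).prod (coordDeriv f Z p))) := by
    have hY' := hY.coord.hasMFDerivAt
    have hZ' := hZ.coord.hasMFDerivAt
    exact ⟨hφ.1.prodMk (hY'.1.prodMk hZ'.1), hφ.2.prodMk (hY'.2.prodMk hZ'.2)⟩
  have htot := HasMFDerivAt.comp p (f := fun q ↦ (extChartAt 𝓘(ℝ, E) (f p) (f q),
    coordAlong (f p) f Y q, coordAlong (f p) f Z q)) hΦ.hasMFDerivAt hprod
  have hself : ∀ Y : ∀ p : P, TangentSpace 𝓘(ℝ, E) (f p), coordAlong (f p) f Y p = Y p :=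
    fun Y ↦ DFunLike.congr_fun (chartDeriv_self (f p)) (Y p)
  have hinner : ∀ v w : TangentSpace 𝓘(ℝ, E) (f p),
      chartMetric (f p) (extChartAt 𝓘(ℝ, E) (f p) (f p)) v w = inner ℝ v w := by
    intro v w
    rw [← chartMetric_coord (mem_chart_source E (f p)) v w, chartDeriv_self]
    rfl
  have h1 : (mfderiv 𝓘(ℝ, E') 𝓘(ℝ, ℝ) (fun q ↦ inner ℝ (Y q) (Z q)) p v : ℝ) =
      L (mfderiv 𝓘(ℝ, E') 𝓘(ℝ, E) f p v, coordDeriv f Y p v, coordDeriv f Z p v) := by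
    rw [hcongr.mfderiv_eq]
    exact DFunLike.congr_fun htot.mfderiv v
  have h2 : fderiv ℝ (chartMetric (f p)) (extChartAt 𝓘(ℝ, E) (f p) (f p))
      (mfderiv 𝓘(ℝ, E') 𝓘(ℝ, E) f p v) (coordAlong (f p) f Y p) (coordAlong (f p) f Z p) =
      inner ℝ (christoffel (f p) (mfderiv 𝓘(ℝ, E') 𝓘(ℝ, E) f p v) (Y p)) (Z p) +
        inner ℝ (christoffel (f p) (mfderiv 𝓘(ℝ, E') 𝓘(ℝ, E) f p v) (Z p)) (Y p) := by
    rw [inner_christoffel, inner_christoffel, hself, hself]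
    exact (christoffelFirst_add _ _ _ _).symm
  have h3 : chartMetric (f p) (extChartAt 𝓘(ℝ, E) (f p) (f p)) (coordDeriv f Y p v)
      (coordAlong (f p) f Z p) = inner ℝ (coordDeriv f Y p v) (Z p) := by
    rw [hself]
    exact hinner _ _
  have h4 : chartMetric (f p) (extChartAt 𝓘(ℝ, E) (f p) (f p)) (coordAlong (f p) f Y p)
      (coordDeriv f Z p v) = inner ℝ (Y p) (coordDeriv f Z p v) := by
    rw [hself]
    exact hinner _ _
  refine (h1.trans (hL _ _ _)).trans
    ((congrArg₂ (· + ·) (congrArg₂ (· + ·) h2 h3) h4).trans ?_)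
  rw [covAlong_eq, covAlong_eq, inner_add_left, inner_add_right,
    real_inner_comm (Y p) (christoffel _ _ (Z p))]
  have hring : ∀ a b c d : ℝ, a + b + c + d = (c + a) + (d + b) := fun a b c d ↦ by ring
  exact hring _ _ _ _

end Connection

/-! ### Chain rule, additivity in the direction, and differentiation of inner products. -/

section Connection

variable {E : Type*} [NormedAddCommGroup E] [NormedSpace ℝ E] [FiniteDimensional ℝ E]
  {N : Type*} [TopologicalSpace N] [ChartedSpace E N] [IsManifold 𝓘(ℝ, E) ∞ N]
  {E' : Type*} [NormedAddCommGroup E'] [NormedSpace ℝ E']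
  {P : Type*} [TopologicalSpace P] [ChartedSpace E' P]

lemma SmoothFieldAt.diffAlong {Z : ∀ x : N, TangentSpace 𝓘(ℝ, E) x} {f : P → N} {p : P}
    (hZ : SmoothFieldAt Z (f p)) (hf : MDifferentiableAt 𝓘(ℝ, E') 𝓘(ℝ, E) f p) :
    DiffAlong (E' := E') f (fun q ↦ Z (f q)) p :=
  MDifferentiableAt.comp p (hZ.mdifferentiableAt (by simp)) hf

lemma DiffAlong.congr {f : P → N} {Y Y' : ∀ p : P, TangentSpace 𝓘(ℝ, E) (f p)} {p : P}
    (hY : DiffAlong (E' := E') f Y p) (h : ∀ᶠ q in 𝓝 p, Y' q = Y q) :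
    DiffAlong (E' := E') f Y' p := by
  refine MDifferentiableAt.congr_of_eventuallyEq hY ?_
  filter_upwards [h] with q hq
  rw [hq]

lemma SmoothFieldAt.sub {Y Z : ∀ x : N, TangentSpace 𝓘(ℝ, E) x} {x : N}
    (hY : SmoothFieldAt Y x) (hZ : SmoothFieldAt Z x) :
    SmoothFieldAt (fun z ↦ Y z - Z z) x :=
  ContMDiffAt.sub_section hY hZ

lemma smoothFieldAt_extend {x : N} (v : TangentSpace 𝓘(ℝ, E) x) :
    SmoothFieldAt (FiberBundle.extend E v) x :=
  FiberBundle.contMDiffAt_extend 𝓘(ℝ, E) E v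

variable [RiemannianBundle (fun x : N ↦ TangentSpace 𝓘(ℝ, E) x)]

lemma IsKaehler.smoothFieldAt
    {J : ∀ y : N, TangentSpace 𝓘(ℝ, E) y →L[ℝ] TangentSpace 𝓘(ℝ, E) y} (hJ : IsKaehler J)
    {Z : ∀ x : N, TangentSpace 𝓘(ℝ, E) x} {x : N} (hZ : SmoothFieldAt Z x) :
    SmoothFieldAt (fun z ↦ J z (Z z)) x :=
  ContMDiffAt.clm_bundle_apply (b := fun z : N ↦ z) (ϕ := J) hJ.smooth.contMDiffAt hZ

lemma covAlong_congr {f : P → N} {Y Y' : ∀ p : P, TangentSpace 𝓘(ℝ, E) (f p)} {p : P}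
    (h : ∀ᶠ q in 𝓝 p, Y q = Y' q) (v : TangentSpace 𝓘(ℝ, E') p) :
    covAlong f Y p v = covAlong f Y' p v := by
  have hc : coordAlong (f p) f Y =ᶠ[𝓝 p] coordAlong (f p) f Y' := by
    filter_upwards [h] with q hq
    rw [coordAlong, coordAlong, hq]
  rw [covAlong_eq, covAlong_eq, h.self_of_nhds]
  congr 1
  exact DFunLike.congr_fun hc.mfderiv_eq v

/-- The chain rule for the pullback connection. -/
lemma covAlong_comp {f : P → N} {Z : ∀ x : N, TangentSpace 𝓘(ℝ, E) x} {p : P}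
    (hZ : SmoothFieldAt Z (f p)) (hf : MDifferentiableAt 𝓘(ℝ, E') 𝓘(ℝ, E) f p)
    (v : TangentSpace 𝓘(ℝ, E') p) :
    covAlong f (fun q ↦ Z (f q)) p v =
      leviCivita Z (f p) (mfderiv 𝓘(ℝ, E') 𝓘(ℝ, E) f p v) := by
  have hc : MDifferentiableAt 𝓘(ℝ, E) 𝓘(ℝ, E) (coordAlong (f p) (fun z : N ↦ z) Z) (f p) :=
    (hZ.diffAlong (f := fun z : N ↦ z) mdifferentiableAt_id).coord
  have h := (hc.hasMFDerivAt.comp p hf.hasMFDerivAt).mfderiv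
  have hid : mfderiv 𝓘(ℝ, E) 𝓘(ℝ, E) (fun z : N ↦ z) (f p) = ContinuousLinearMap.id ℝ _ :=
    mfderiv_id
  rw [leviCivita, covAlong_eq, covAlong_eq, hid]
  exact congrArg (· + christoffel (f p) (mfderiv 𝓘(ℝ, E') 𝓘(ℝ, E) f p v) (Z (f p)))
    (DFunLike.congr_fun h v)

lemma christoffel_add_left (x : N) (v w u : TangentSpace 𝓘(ℝ, E) x) :
    christoffel x (v + w) u = christoffel x v u + christoffel x w u := by
  rw [christoffel, map_add, christoffelFirst_add_left, ContinuousLinearMap.add_comp, map_add]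
  rfl

lemma leviCivita_add (Z : ∀ x : N, TangentSpace 𝓘(ℝ, E) x) (x : N)
    (v w : TangentSpace 𝓘(ℝ, E) x) :
    leviCivita Z x (v + w) = leviCivita Z x v + leviCivita Z x w := by
  have hid : mfderiv 𝓘(ℝ, E) 𝓘(ℝ, E) (fun z : N ↦ z) x = ContinuousLinearMap.id ℝ _ :=
    mfderiv_id
  rw [leviCivita, leviCivita, leviCivita, covAlong_eq, covAlong_eq, covAlong_eq, hid,
    map_add, map_add]
  simp only [ContinuousLinearMap.id_apply]
  rw [christoffel_add_left]
  abel

variable [IsContMDiffRiemannianBundle 𝓘(ℝ, E) ∞ E (fun x : N ↦ TangentSpace 𝓘(ℝ, E) x)]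

/-- The pullback connection differentiates inner products of fields along a curve. -/
lemma hasDerivAt_inner_along {β : ℝ → N} {Y Z : ∀ t : ℝ, TangentSpace 𝓘(ℝ, E) (β t)} {t : ℝ}
    (hY : DiffAlong (E' := ℝ) β Y t) (hZ : DiffAlong (E' := ℝ) β Z t) :
    HasDerivAt (fun τ ↦ inner ℝ (Y τ) (Z τ))
      (inner ℝ (covAlong β Y t (1 : ℝ)) (Z t) + inner ℝ (Y t) (covAlong β Z t (1 : ℝ))) t := by
  have hd := (hY.inner hZ).differentiableAt.hasDerivAt
  have h := mfderiv_inner_along hY hZ (1 : ℝ)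
  rw [← h]
  convert hd using 1
  rw [← fderiv_apply_one_eq_deriv, mfderiv_eq_fderiv]
  rfl

/-- Orthogonal fields stay orthogonal to first order. -/
lemma inner_covAlong_eq_neg {f : P → N} {Y Z : ∀ p : P, TangentSpace 𝓘(ℝ, E) (f p)} {p : P}
    (hY : DiffAlong (E' := E') f Y p) (hZ : DiffAlong (E' := E') f Z p)
    (h : ∀ᶠ q in 𝓝 p, inner ℝ (Y q) (Z q) = 0) (v : TangentSpace 𝓘(ℝ, E') p) :
    inner ℝ (covAlong f Y p v) (Z p) = -inner ℝ (Y p) (covAlong f Z p v) := by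
  have h0 := mfderiv_inner_along hY hZ v
  have hc : (fun q ↦ inner ℝ (Y q) (Z q)) =ᶠ[𝓝 p] fun _ ↦ (0 : ℝ) := h
  rw [hc.mfderiv_eq, mfderiv_const] at h0
  have h1 : (0 : ℝ) = _ := h0
  linarith

end Connection

/-! ### Velocity of a smooth curve and its extension to the ambient manifold. -/

section Curves

variable {E : Type*} [NormedAddCommGroup E] [NormedSpace ℝ E] [FiniteDimensional ℝ E]
  {N : Type*} [TopologicalSpace N] [ChartedSpace E N] [IsManifold 𝓘(ℝ, E) ∞ N]
  {β : ℝ → N} {I : Set ℝ} {t : ℝ}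

/-- A curve in the chart centred at `x`. -/
noncomputable def chartCurve (x : N) (β : ℝ → N) (τ : ℝ) : E := extChartAt 𝓘(ℝ, E) x (β τ)

lemma contDiffAt_chartCurve {x : N} (hβ : ContMDiffAt 𝓘(ℝ, ℝ) 𝓘(ℝ, E) ∞ β t)
    (ht : β t ∈ (chartAt E x).source) : ContDiffAt ℝ ∞ (chartCurve (E := E) x β) t :=
  ((contMDiffAt_extChartAt' (I := 𝓘(ℝ, E)) (n := ∞) ht).comp t hβ).contDiffAt

lemma chartDeriv_velocity {x : N} (hβ : MDifferentiableAt 𝓘(ℝ, ℝ) 𝓘(ℝ, E) β t)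
    (ht : β t ∈ (chartAt E x).source) :
    chartDeriv x (β t) (velocity β t) = deriv (chartCurve (E := E) x β) t := by
  have h := ((mdifferentiableAt_extChartAt (I := 𝓘(ℝ, E)) ht).hasMFDerivAt.comp t
    hβ.hasMFDerivAt).mfderiv
  rw [← fderiv_apply_one_eq_deriv, ← mfderiv_eq_fderiv]
  exact (DFunLike.congr_fun h (1 : ℝ)).symm

lemma eventually_chartDeriv_velocity (hI : IsOpen I)
    (hβ : ContMDiffOn 𝓘(ℝ, ℝ) 𝓘(ℝ, E) ∞ β I) (ht : t ∈ I) :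
    ∀ᶠ τ in 𝓝 t, β τ ∈ (chartAt E (β t)).source ∧
      chartDeriv (β t) (β τ) (velocity β τ) = deriv (chartCurve (E := E) (β t) β) τ := by
  have hc : ContinuousAt β t := (hβ.contMDiffAt (hI.mem_nhds ht)).continuousAt
  filter_upwards [eventually_mem_chartSource (E := E) hc, hI.mem_nhds ht] with τ hτ hτI
  exact ⟨hτ, chartDeriv_velocity
    ((hβ.contMDiffAt (hI.mem_nhds hτI)).mdifferentiableAt (by simp)) hτ⟩

lemma contDiffAt_deriv_chartCurve (hβ : ContMDiffAt 𝓘(ℝ, ℝ) 𝓘(ℝ, E) ∞ β t) :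
    ContDiffAt ℝ ∞ (deriv (chartCurve (E := E) (β t) β)) t :=
  (contDiffAt_chartCurve hβ (mem_chart_source E (β t))).derivWithin (by simp)

lemma diffAlong_velocity (hI : IsOpen I)
    (hβ : ContMDiffOn 𝓘(ℝ, ℝ) 𝓘(ℝ, E) ∞ β I) (ht : t ∈ I) :
    DiffAlong (E' := ℝ) β (velocity (E := E) β) t := by
  have hβt := hβ.contMDiffAt (hI.mem_nhds ht)
  rw [DiffAlong, mdifferentiableAt_totalSpace]
  refine ⟨hβt.mdifferentiableAt (by simp), ?_⟩
  refine MDifferentiableAt.congr_of_eventuallyEq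
    ((contDiffAt_deriv_chartCurve hβt).differentiableAt (by simp)).mdifferentiableAt ?_
  filter_upwards [eventually_chartDeriv_velocity hI hβ ht] with τ hτ
  exact (chartDeriv_eq_trivialization hτ.1 _).symm.trans hτ.2

/-- Near a point where it is regular, a smooth curve has a smooth local left inverse. -/
lemma exists_smooth_leftInverse (hI : IsOpen I)
    (hβ : ContMDiffOn 𝓘(ℝ, ℝ) 𝓘(ℝ, E) ∞ β I) (ht : t ∈ I) (h0 : velocity (E := E) β t ≠ 0) :
    ∃ σ : N → ℝ, ContMDiffAt 𝓘(ℝ, E) 𝓘(ℝ, ℝ) ∞ σ (β t) ∧ ∀ᶠ τ in 𝓝 t, σ (β τ) = τ := by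
  have hβt := hβ.contMDiffAt (hI.mem_nhds ht)
  have hc := contDiffAt_chartCurve hβt (mem_chart_source E (β t))
  have hv := chartDeriv_velocity (hβt.mdifferentiableAt (by simp)) (mem_chart_source E (β t))
  have hne : deriv (chartCurve (E := E) (β t) β) t ≠ 0 := by
    rw [← hv, chartDeriv_self]
    exact h0
  -- A functional that does not kill the chart velocity turns the curve into a scalar function with
  -- nonzero derivative, to which the one-variable inverse function theorem applies.
  obtain ⟨ℓ, hℓ⟩ := SeparatingDual.exists_ne_zero (R := ℝ) hne
  have hd : HasDerivAt (fun τ ↦ ℓ (chartCurve (E := E) (β t) β τ)) (ℓ (deriv (chartCurve (E := E) (β t) β) t)) t :=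
    ℓ.hasFDerivAt.comp_hasDerivAt t (hc.differentiableAt (by simp)).hasDerivAt
  have hs : ContDiffAt ℝ ∞ (fun τ ↦ ℓ (chartCurve (E := E) (β t) β τ)) t :=
    ℓ.contDiff.contDiffAt.comp t hc
  have hf := hd.hasFDerivAt_equiv hℓ
  refine ⟨fun z ↦ hs.localInverse hf (by simp) (ℓ (extChartAt 𝓘(ℝ, E) (β t) z)), ?_, ?_⟩
  · have h1 : ContMDiffAt 𝓘(ℝ, E) 𝓘(ℝ, E) ∞ (extChartAt 𝓘(ℝ, E) (β t)) (β t) :=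
      contMDiffAt_extChartAt
    have h2 := ℓ.contDiff (n := ∞).contMDiff.contMDiffAt.comp (β t) h1
    exact (hs.to_localInverse hf (by simp)).contMDiffAt.comp (β t) h2
  · exact (hs.hasStrictFDerivAt' hf (by simp)).eventually_left_inverse

/-- Near a point where it is nonzero, the velocity of a curve extends to a smooth vector field. -/
lemma exists_smoothFieldAt_velocity (hI : IsOpen I)
    (hβ : ContMDiffOn 𝓘(ℝ, ℝ) 𝓘(ℝ, E) ∞ β I) (ht : t ∈ I) (h0 : velocity (E := E) β t ≠ 0) :
    ∃ W : ∀ x : N, TangentSpace 𝓘(ℝ, E) x, SmoothFieldAt W (β t) ∧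
      ∀ᶠ τ in 𝓝 t, W (β τ) = velocity β τ := by
  have hβt := hβ.contMDiffAt (hI.mem_nhds ht)
  obtain ⟨σ, hσ, hσβ⟩ := exists_smooth_leftInverse hI hβ ht h0
  -- The left inverse σ assigns a time to each nearby point; the chart velocity at that time is
  -- carried back to the tangent space at the point.
  refine ⟨fun z ↦ (trivializationAt E (TangentSpace 𝓘(ℝ, E)) (β t)).symmL ℝ z
    (deriv (chartCurve (E := E) (β t) β) (σ z)), ?_, ?_⟩
  · rw [SmoothFieldAt, contMDiffAt_section]
    have hd : ContDiffAt ℝ ∞ (deriv (chartCurve (E := E) (β t) β)) (σ (β t)) := by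
      rw [hσβ.self_of_nhds]
      exact contDiffAt_deriv_chartCurve hβt
    refine (hd.contMDiffAt.comp (β t) hσ).congr_of_eventuallyEq ?_
    filter_upwards [(chartAt E (β t)).open_source.mem_nhds (mem_chart_source E (β t))] with z hz
    rw [← Trivialization.continuousLinearMapAt_apply_of_mem (R := ℝ)]
    · exact Trivialization.continuousLinearMapAt_symmL _ (by simpa using hz) _
    · simpa using hz
  · filter_upwards [hσβ, eventually_chartDeriv_velocity hI hβ ht] with τ h1 h2
    rw [h1, ← h2.2, chartDeriv, ← TangentBundle.continuousLinearMapAt_trivializationAt h2.1]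
    exact Trivialization.symmL_continuousLinearMapAt _ (by simpa using h2.1) _

end Curves

/-! ### Pushforwards of vector fields as fields along F. -/

section Push

variable {E₁ : Type*} [NormedAddCommGroup E₁] [NormedSpace ℝ E₁] [FiniteDimensional ℝ E₁]
  {M : Type*} [TopologicalSpace M] [ChartedSpace E₁ M] [IsManifold 𝓘(ℝ, E₁) ∞ M]
  {E₂ : Type*} [NormedAddCommGroup E₂] [NormedSpace ℝ E₂]
  {N : Type*} [TopologicalSpace N] [ChartedSpace E₂ N] [IsManifold 𝓘(ℝ, E₂) ∞ N]

lemma diffAlong_push {F : M → N} (hF : ContMDiff 𝓘(ℝ, E₁) 𝓘(ℝ, E₂) ∞ F)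
    {Y : ∀ x : M, TangentSpace 𝓘(ℝ, E₁) x} {p : M} (hY : SmoothFieldAt Y p) :
    DiffAlong (E' := E₁) F (fun q ↦ push (E₂ := E₂) F q (Y q)) p := by
  have h := (hF.contMDiff_tangentMap (m := ∞) (by simp)).contMDiffAt.comp p hY
  exact h.mdifferentiableAt (by simp)

end Push

/-! ### Tangential and normal projections, normal extensions and the adjoint of F_*. -/

section Map

variable {E₁ : Type*} [NormedAddCommGroup E₁] [NormedSpace ℝ E₁] [FiniteDimensional ℝ E₁]
  {M : Type*} [TopologicalSpace M] [ChartedSpace E₁ M] [IsManifold 𝓘(ℝ, E₁) ∞ M]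
  {E₂ : Type*} [NormedAddCommGroup E₂] [NormedSpace ℝ E₂] [FiniteDimensional ℝ E₂]
  {N : Type*} [TopologicalSpace N] [ChartedSpace E₂ N] [IsManifold 𝓘(ℝ, E₂) ∞ N]
  [RiemannianBundle (fun x : N ↦ TangentSpace 𝓘(ℝ, E₂) x)]

section Parts

variable {F : M → N} {p : M}

lemma tangPart_mem (v : TangentSpace 𝓘(ℝ, E₂) (F p)) :
    tangPart (E₁ := E₁) F p v ∈ rangeAt (E₁ := E₁) (E₂ := E₂) F p :=
  Submodule.starProjection_apply_mem _ v

lemma normPart_mem (v : TangentSpace 𝓘(ℝ, E₂) (F p)) :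
    normPart (E₁ := E₁) F p v ∈ (rangeAt (E₁ := E₁) (E₂ := E₂) F p)ᗮ :=
  Submodule.starProjection_apply_mem _ v

lemma normPart_eq (v : TangentSpace 𝓘(ℝ, E₂) (F p)) :
    normPart (E₁ := E₁) F p v = v - tangPart (E₁ := E₁) F p v :=
  Submodule.starProjection_orthogonal_val v

lemma inner_tangPart {v w : TangentSpace 𝓘(ℝ, E₂) (F p)}
    (hw : w ∈ rangeAt (E₁ := E₁) (E₂ := E₂) F p) :
    inner ℝ (tangPart (E₁ := E₁) F p v) w = inner ℝ v w := by
  rw [tangPart, Submodule.inner_starProjection_left_eq_right,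
    Submodule.starProjection_eq_self_iff.2 hw]

lemma inner_normPart {v w : TangentSpace 𝓘(ℝ, E₂) (F p)}
    (hw : w ∈ (rangeAt (E₁ := E₁) (E₂ := E₂) F p)ᗮ) :
    inner ℝ (normPart (E₁ := E₁) F p v) w = inner ℝ v w := by
  rw [normPart, Submodule.inner_starProjection_left_eq_right,
    Submodule.starProjection_eq_self_iff.2 hw]

lemma tangPart_add_of_mem {v w : TangentSpace 𝓘(ℝ, E₂) (F p)}
    (hv : v ∈ rangeAt (E₁ := E₁) (E₂ := E₂) F p)
    (hw : w ∈ (rangeAt (E₁ := E₁) (E₂ := E₂) F p)ᗮ) :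
    tangPart (E₁ := E₁) F p (v + w) = v := by
  rw [map_add, tangPart, Submodule.starProjection_eq_self_iff.2 hv,
    (Submodule.starProjection_apply_eq_zero_iff _).2 hw, add_zero]

lemma starProjection_eq_tangPart {K : Submodule ℝ (TangentSpace 𝓘(ℝ, E₂) (F p))}
    (hK : K = rangeAt (E₁ := E₁) (E₂ := E₂) F p) (v : TangentSpace 𝓘(ℝ, E₂) (F p)) :
    K.starProjection v = tangPart (E₁ := E₁) F p v := by
  subst hK
  rfl

end Parts

/-- The section `z ↦ e z - (projection of e z to D z)` of `Dᗮ`, where `e` extends `ν`. -/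
noncomputable def normalExt (D : ∀ y : N, Submodule ℝ (TangentSpace 𝓘(ℝ, E₂) y)) {y : N}
    (ν : TangentSpace 𝓘(ℝ, E₂) y) (z : N) : TangentSpace 𝓘(ℝ, E₂) z :=
  FiberBundle.extend E₂ ν z - (D z).starProjection (FiberBundle.extend E₂ ν z)

section Distribution

variable {D : ∀ y : N, Submodule ℝ (TangentSpace 𝓘(ℝ, E₂) y)} {y : N}

lemma normalExt_mem (ν : TangentSpace 𝓘(ℝ, E₂) y) (z : N) : normalExt D ν z ∈ (D z)ᗮ :=
  Submodule.sub_starProjection_mem_orthogonal _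

lemma normalExt_self {ν : TangentSpace 𝓘(ℝ, E₂) y} (h : ν ∈ (D y)ᗮ) : normalExt D ν y = ν := by
  rw [normalExt, FiberBundle.extend_apply_self, (Submodule.starProjection_apply_eq_zero_iff _).2 h,
    sub_zero]

lemma smoothFieldAt_normalExt
    (hD : ∀ Y : ∀ y : N, TangentSpace 𝓘(ℝ, E₂) y, SmoothFieldAt Y y →
      SmoothFieldAt (fun z ↦ (D z).starProjection (Y z)) y)
    (ν : TangentSpace 𝓘(ℝ, E₂) y) : SmoothFieldAt (normalExt D ν) y :=
  (smoothFieldAt_extend ν).sub (hD _ (smoothFieldAt_extend ν))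

/-- The extension in the definition of `shapeOp`, a priori only a field along F, is the restriction
of a section of Dᗮ on N, so it can also be differentiated in directions outside `range F_*`. -/
lemma normPart_extend {F : M → N} (hD : ∀ p, D (F p) = rangeAt (E₁ := E₁) (E₂ := E₂) F p)
    (ν : TangentSpace 𝓘(ℝ, E₂) y) (q : M) :
    normPart (E₁ := E₁) F q (FiberBundle.extend E₂ ν (F q)) = normalExt D ν (F q) := by
  rw [normPart_eq, normalExt, starProjection_eq_tangPart (hD q)]

end Distribution

variable [RiemannianBundle (fun x : M ↦ TangentSpace 𝓘(ℝ, E₁) x)] {F : M → N}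

lemma inner_adjoint_push (p : M) (X : TangentSpace 𝓘(ℝ, E₁) p)
    (w : TangentSpace 𝓘(ℝ, E₂) (F p)) :
    inner ℝ (ContinuousLinearMap.adjoint (push F p) w) X =
      inner ℝ w (push (E₁ := E₁) F p X) :=
  ContinuousLinearMap.adjoint_inner_left _ _ _

lemma adjoint_push_mem (p : M) (w : TangentSpace 𝓘(ℝ, E₂) (F p)) :
    ContinuousLinearMap.adjoint (push F p) w ∈ (kerAt (E₁ := E₁) (E₂ := E₂) F p)ᗮ := by
  rw [Submodule.mem_orthogonal']
  intro X hX
  rw [inner_adjoint_push, show push (E₂ := E₂) F p X = 0 from hX, inner_zero_right]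

lemma IsRiemannianMap.adjoint_push_push (hF : IsRiemannianMap (E₁ := E₁) (E₂ := E₂) F) {p : M}
    {X : TangentSpace 𝓘(ℝ, E₁) p} (hX : X ∈ (kerAt (E₁ := E₁) (E₂ := E₂) F p)ᗮ) :
    ContinuousLinearMap.adjoint (push F p) (push (E₂ := E₂) F p X) = X := by
  have hmem := Submodule.sub_mem _ (adjoint_push_mem p (push (E₂ := E₂) F p X)) hX
  rw [← sub_eq_zero, ← inner_self_eq_zero (𝕜 := ℝ)]
  conv_lhs => rw [inner_sub_left]
  rw [inner_adjoint_push, hF.isometry p _ hX _ hmem, sub_self]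

/-- A Riemannian map is an isometry from `(ker F_*)ᗮ` onto `range F_*`, so there the adjoint inverts
it; the kernel component of a preimage can be dropped. -/
lemma IsRiemannianMap.push_adjoint_push (hF : IsRiemannianMap (E₁ := E₁) (E₂ := E₂) F) {p : M}
    {w : TangentSpace 𝓘(ℝ, E₂) (F p)} (hw : w ∈ rangeAt (E₁ := E₁) (E₂ := E₂) F p) :
    push (E₁ := E₁) F p (ContinuousLinearMap.adjoint (push F p) w) = w := by
  obtain ⟨X, hX⟩ := hw
  have hX' : push F p X = w := hX
  set K := kerAt (E₁ := E₁) (E₂ := E₂) F p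
  have h0 : push (E₂ := E₂) F p (K.starProjection X) = 0 := K.starProjection_apply_mem X
  have h1 : push (E₂ := E₂) F p (Kᗮ.starProjection X) = w := by
    rw [Submodule.starProjection_orthogonal_val, map_sub, h0, sub_zero, hX']
  rw [← h1, hF.adjoint_push_push (Submodule.starProjection_apply_mem _ X)]

variable [IsContMDiffRiemannianBundle 𝓘(ℝ, E₂) ∞ E₂ (fun y : N ↦ TangentSpace 𝓘(ℝ, E₂) y)]

/-! ### The shape operator and Weingarten's equation. -/

section Shape

variable {D : ∀ y : N, Submodule ℝ (TangentSpace 𝓘(ℝ, E₂) y)} {p : M}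

lemma inner_shapeOp (hF : ContMDiff 𝓘(ℝ, E₁) 𝓘(ℝ, E₂) ∞ F)
    (hDF : ∀ p, D (F p) = rangeAt (E₁ := E₁) (E₂ := E₂) F p)
    (hD : ∀ Y : ∀ y : N, TangentSpace 𝓘(ℝ, E₂) y, SmoothFieldAt Y (F p) →
      SmoothFieldAt (fun z ↦ (D z).starProjection (Y z)) (F p))
    (ν : TangentSpace 𝓘(ℝ, E₂) (F p)) (X : TangentSpace 𝓘(ℝ, E₁) p)
    {w : TangentSpace 𝓘(ℝ, E₂) (F p)} (hw : w ∈ rangeAt (E₁ := E₁) (E₂ := E₂) F p) :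
    inner ℝ (shapeOp F p ν X) w =
      -inner ℝ (leviCivita (normalExt D ν) (F p) (push F p X)) w := by
  rw [shapeOp, inner_neg_left, inner_tangPart hw]
  simp only [normPart_extend hDF]
  rw [covAlong_comp (smoothFieldAt_normalExt hD ν) (hF.mdifferentiableAt (by simp))]
  rfl

/-- Pushed-forward fields stay orthogonal to the normal extension of ν, so the derivative moves from
one factor to the other with a sign. The term F_*(∇^M) is tangential and drops out against ν. -/
lemma inner_shapeOp_eq_inner_secondFF (hF : IsRiemannianMap (E₁ := E₁) (E₂ := E₂) F)
    (hDF : ∀ p, D (F p) = rangeAt (E₁ := E₁) (E₂ := E₂) F p)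
    (hD : ∀ Y : ∀ y : N, TangentSpace 𝓘(ℝ, E₂) y, SmoothFieldAt Y (F p) →
      SmoothFieldAt (fun z ↦ (D z).starProjection (Y z)) (F p))
    {ν w : TangentSpace 𝓘(ℝ, E₂) (F p)} (X : TangentSpace 𝓘(ℝ, E₁) p)
    (hν : ν ∈ (rangeAt (E₁ := E₁) (E₂ := E₂) F p)ᗮ)
    (hw : w ∈ rangeAt (E₁ := E₁) (E₂ := E₂) F p) :
    inner ℝ (shapeOp F p ν X) w =
      inner ℝ (secondFF F p X (ContinuousLinearMap.adjoint (push F p) w)) ν := by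
  have hdF := hF.smooth.mdifferentiableAt (x := p) (by simp)
  have hs := smoothFieldAt_normalExt hD ν
  set Y : TangentSpace 𝓘(ℝ, E₁) p := ContinuousLinearMap.adjoint (push F p) w with hYdef
  have h0 : ∀ q : M, inner ℝ (push (E₁ := E₁) F q (FiberBundle.extend E₁ Y q))
      (normalExt D ν (F q)) = 0 := by
    intro q
    refine Submodule.inner_right_of_mem_orthogonal (K := D (F q)) ?_ (normalExt_mem ν (F q))
    rw [hDF]
    exact ⟨_, rfl⟩
  have h1 := inner_covAlong_eq_neg (diffAlong_push hF.smooth (smoothFieldAt_extend Y))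
    (hs.diffAlong hdF) (Eventually.of_forall h0) X
  rw [FiberBundle.extend_apply_self, normalExt_self (by rwa [hDF]), covAlong_comp hs hdF,
    hYdef, hF.push_adjoint_push hw, ← hYdef] at h1
  have h2 : inner ℝ (push F p (leviCivita (FiberBundle.extend E₁ Y) p X)) ν = 0 :=
    Submodule.inner_right_of_mem_orthogonal (K := rangeAt (E₁ := E₁) (E₂ := E₂) F p) ⟨_, rfl⟩ hν
  rw [inner_shapeOp hF.smooth hDF hD ν X hw, secondFF, inner_sub_left, h1, h2,
    sub_zero, real_inner_comm]
  rfl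

end Shape

end Map

/-! ### The terms of (∗) without g reduce to -⟨∇T, T⟩. -/

section Clairaut

variable {E₁ : Type*} [NormedAddCommGroup E₁] [NormedSpace ℝ E₁] [FiniteDimensional ℝ E₁]
  {M : Type*} [TopologicalSpace M] [ChartedSpace E₁ M] [IsManifold 𝓘(ℝ, E₁) ∞ M]
  [RiemannianBundle (fun x : M ↦ TangentSpace 𝓘(ℝ, E₁) x)]
  {E₂ : Type*} [NormedAddCommGroup E₂] [NormedSpace ℝ E₂] [FiniteDimensional ℝ E₂]
  {N : Type*} [TopologicalSpace N] [ChartedSpace E₂ N] [IsManifold 𝓘(ℝ, E₂) ∞ N]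
  [RiemannianBundle (fun x : N ↦ TangentSpace 𝓘(ℝ, E₂) x)]
  [IsContMDiffRiemannianBundle 𝓘(ℝ, E₂) ∞ E₂ (fun y : N ↦ TangentSpace 𝓘(ℝ, E₂) y)]
  {J : ∀ y : N, TangentSpace 𝓘(ℝ, E₂) y →L[ℝ] TangentSpace 𝓘(ℝ, E₂) y}
  {F : M → N} {α : ℝ → M} {I : Set ℝ} {t : ℝ}

/-- The component in `range F_*` of the velocity of `F ∘ α`. -/
noncomputable def velTang (F : M → N) (α : ℝ → M) (τ : ℝ) : TangentSpace 𝓘(ℝ, E₂) ((F ∘ α) τ) :=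
  tangPart (E₁ := E₁) F (α τ) (velocity (E := E₂) (F ∘ α) τ)

section Expression

variable {D : ∀ y : N, Submodule ℝ (TangentSpace 𝓘(ℝ, E₂) y)}

/-- Along a geodesic, the derivative of `velTang` has the same inner product with the normal and
with the tangential component of the velocity. -/
lemma inner_covAlong_velTang (hI : IsOpen I) (hβ : IsGeodesicOn (E := E₂) (F ∘ α) I) (ht : t ∈ I)
    (hT : DiffAlong (E' := ℝ) (F ∘ α) (velTang (E₁ := E₁) (E₂ := E₂) F α) t) :
    inner ℝ (covAlong (F ∘ α) (velTang (E₁ := E₁) (E₂ := E₂) F α) t (1 : ℝ))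
        (velocity (E := E₂) (F ∘ α) t) =
      2 * inner ℝ (covAlong (F ∘ α) (velTang (E₁ := E₁) (E₂ := E₂) F α) t (1 : ℝ))
        (velTang (E₁ := E₁) (E₂ := E₂) F α t) := by
  have h1 := hasDerivAt_inner_along hT hT
  have h2 := hasDerivAt_inner_along hT (diffAlong_velocity hI hβ.1 ht)
  have heq : ∀ τ, inner ℝ (velTang (E₁ := E₁) (E₂ := E₂) F α τ)
      (velTang (E₁ := E₁) (E₂ := E₂) F α τ) =
      inner ℝ (velTang (E₁ := E₁) (E₂ := E₂) F α τ) (velocity (E := E₂) (F ∘ α) τ) := by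
    intro τ
    rw [real_inner_comm]
    conv_rhs => rw [real_inner_comm]
    exact inner_tangPart (tangPart_mem _)
  simp only [heq] at h1
  have h3 := h1.unique h2
  rw [hβ.2 t ht, inner_zero_right, add_zero] at h3
  rw [← h3, real_inner_comm (velTang F α t), two_mul]

/-- `⟨S_{JF_*X} F_*X, w⟩ = -⟨∇_{β'} JF_*X, w⟩` for `w` in `range F_*`. -/
lemma inner_shapeOp_velTang (hJ : IsKaehler J)
    (hF : IsRiemannianMap (E₁ := E₁) (E₂ := E₂) F)
    (hanti : IsAntiInvariant (E₁ := E₁) F J)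
    (hDF : ∀ p, D (F p) = rangeAt (E₁ := E₁) (E₂ := E₂) F p)
    (hD : ∀ p, ∀ Y : ∀ y : N, TangentSpace 𝓘(ℝ, E₂) y, SmoothFieldAt Y (F p) →
      SmoothFieldAt (fun z ↦ (D z).starProjection (Y z)) (F p))
    (hgeod : ∀ p, ∀ u ∈ (D (F p))ᗮ, ∀ V : ∀ y : N, TangentSpace 𝓘(ℝ, E₂) y,
      SmoothFieldAt V (F p) → (∀ᶠ z in 𝓝 (F p), V z ∈ (D z)ᗮ) →
      leviCivita V (F p) u ∈ (D (F p))ᗮ)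
    (hdβ : MDifferentiableAt 𝓘(ℝ, ℝ) 𝓘(ℝ, E₂) (F ∘ α) t)
    {X : TangentSpace 𝓘(ℝ, E₁) (α t)} {V w : TangentSpace 𝓘(ℝ, E₂) (F (α t))}
    {Z : ∀ y : N, TangentSpace 𝓘(ℝ, E₂) y}
    (hV : V ∈ (rangeAt (E₁ := E₁) (E₂ := E₂) F (α t))ᗮ)
    (hw : w ∈ rangeAt (E₁ := E₁) (E₂ := E₂) F (α t))
    (hvel : velocity (E := E₂) (F ∘ α) t = push F (α t) X + V)
    (hZ : SmoothFieldAt Z (F (α t))) (hZ0 : Z (F (α t)) = push F (α t) X)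
    (hZT : ∀ᶠ τ in 𝓝 t, Z (F (α τ)) = velTang (E₁ := E₁) F α τ) :
    inner ℝ (shapeOp F (α t) (J (F (α t)) (push F (α t) X)) X) w =
      -inner ℝ (leviCivita (fun y ↦ J y (Z y)) (F (α t)) (velocity (E := E₂) (F ∘ α) t)) w := by
  obtain ⟨ν, hν⟩ : ∃ ν, ν = J (F (α t)) (push F (α t) X) := ⟨_, rfl⟩
  rw [← hν]
  have hνm : ν ∈ (D (F (α t)))ᗮ := by
    rw [hDF, hν]
    exact hanti (α t) _ ⟨X, rfl⟩
  have hwD : w ∈ D (F (α t)) := by rwa [hDF]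
  have hJZs : SmoothFieldAt (fun y ↦ J y (Z y)) (F (α t)) := hJ.smoothFieldAt hZ
  have hbs : SmoothFieldAt (fun z ↦ (D z).starProjection (FiberBundle.extend E₂ w z)) (F (α t)) :=
    hD (α t) _ (smoothFieldAt_extend w)
  have hb0 : (D (F (α t))).starProjection (FiberBundle.extend E₂ w (F (α t))) = w := by
    rw [FiberBundle.extend_apply_self]
    exact Submodule.starProjection_eq_self_iff.2 hwD
  have hνs := smoothFieldAt_normalExt (hD (α t)) ν
  -- Total geodesy enters here: differentiating in the direction V adds nothing tangential, so F_*X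
  -- can be replaced by β'.
  have hVν : leviCivita (normalExt D ν) (F (α t)) V ∈ (D (F (α t)))ᗮ :=
    hgeod (α t) V (by rwa [hDF]) _ hνs (Eventually.of_forall (normalExt_mem ν))
  have hVB : inner ℝ (leviCivita (normalExt D ν) (F (α t)) V) w = 0 :=
    Submodule.inner_left_of_mem_orthogonal hwD hVν
  have h1 : inner ℝ (shapeOp F (α t) ν X) w =
      -inner ℝ (leviCivita (normalExt D ν) (F (α t)) (velocity (E := E₂) (F ∘ α) t)) w := by
    rw [inner_shapeOp hF.smooth hDF (hD (α t)) ν X hw, hvel, leviCivita_add, inner_add_left, hVB,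
      add_zero]
  -- JZ is normal only along β, by anti-invariance. Both it and the normal extension of ν are thus
  -- orthogonal along β to one section of D through `w`, and they agree at time `t`; so their
  -- derivatives have the same product with `w`, namely -⟨ν, c⟩.
  have hort : ∀ᶠ τ in 𝓝 t, inner ℝ (J (F (α τ)) (Z (F (α τ))))
      ((D (F (α τ))).starProjection (FiberBundle.extend E₂ w (F (α τ)))) = 0 := by
    filter_upwards [hZT] with τ hτ
    rw [hτ]
    refine Submodule.inner_left_of_mem_orthogonal (K := rangeAt (E₁ := E₁) (E₂ := E₂) F (α τ))
      ?_ (hanti (α τ) _ (tangPart_mem _))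
    rw [← hDF]
    exact Submodule.starProjection_apply_mem _ _
  have h2 := inner_covAlong_eq_neg (hνs.diffAlong (f := F ∘ α) (p := t) hdβ)
    (hbs.diffAlong (f := F ∘ α) (p := t) hdβ) (Eventually.of_forall fun τ ↦
      Submodule.inner_left_of_mem_orthogonal
        (Submodule.starProjection_apply_mem _ _) (normalExt_mem ν _)) (1 : ℝ)
  have h3 := inner_covAlong_eq_neg (hJZs.diffAlong (f := F ∘ α) (p := t) hdβ)
    (hbs.diffAlong (f := F ∘ α) (p := t) hdβ) hort (1 : ℝ)
  obtain ⟨c, hc⟩ : ∃ c : TangentSpace 𝓘(ℝ, E₂) (F (α t)), c = covAlong (F ∘ α)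
      (fun τ ↦ (D (F (α τ))).starProjection (FiberBundle.extend E₂ w (F (α τ)))) t (1 : ℝ) :=
    ⟨_, rfl⟩
  have h4 : inner ℝ (leviCivita (normalExt D ν) (F (α t)) (velocity (E := E₂) (F ∘ α) t)) w =
      -inner ℝ ν c := by
    have hcomp : covAlong (F ∘ α) (fun τ ↦ normalExt D ν (F (α τ))) t (1 : ℝ) =
        leviCivita (normalExt D ν) (F (α t)) (velocity (E := E₂) (F ∘ α) t) :=
      covAlong_comp (f := F ∘ α) hνs hdβ (1 : ℝ)
    rw [← hcomp, hc]
    exact (congrArg (inner ℝ _) hb0.symm).trans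
      (h2.trans (congrArg (fun u ↦ -inner ℝ u _) (normalExt_self hνm)))
  have h5 : inner ℝ (leviCivita (fun y ↦ J y (Z y)) (F (α t)) (velocity (E := E₂) (F ∘ α) t)) w =
      -inner ℝ ν c := by
    have hcomp : covAlong (F ∘ α) (fun τ ↦ J (F (α τ)) (Z (F (α τ)))) t (1 : ℝ) =
        leviCivita (fun y ↦ J y (Z y)) (F (α t)) (velocity (E := E₂) (F ∘ α) t) :=
      covAlong_comp (f := F ∘ α) hJZs hdβ (1 : ℝ)
    rw [← hcomp, hc, hν, ← hZ0]
    exact (congrArg (inner ℝ _) hb0.symm).trans h3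
  rw [h1, h4, h5]

/-- The right-hand side does not involve `Z`, which is why requiring (∗) for every extension or for
a single one amounts to the same. -/
lemma clairaut_expression_eq (hJ : IsKaehler J)
    (hF : IsRiemannianMap (E₁ := E₁) (E₂ := E₂) F)
    (hanti : IsAntiInvariant (E₁ := E₁) F J)
    (hDF : ∀ p, D (F p) = rangeAt (E₁ := E₁) (E₂ := E₂) F p)
    (hD : ∀ p, ∀ Y : ∀ y : N, TangentSpace 𝓘(ℝ, E₂) y, SmoothFieldAt Y (F p) →
      SmoothFieldAt (fun z ↦ (D z).starProjection (Y z)) (F p))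
    (hgeod : ∀ p, ∀ u ∈ (D (F p))ᗮ, ∀ V : ∀ y : N, TangentSpace 𝓘(ℝ, E₂) y,
      SmoothFieldAt V (F p) → (∀ᶠ z in 𝓝 (F p), V z ∈ (D z)ᗮ) →
      leviCivita V (F p) u ∈ (D (F p))ᗮ)
    (hI : IsOpen I) (hβ : IsGeodesicOn (E := E₂) (F ∘ α) I) (ht : t ∈ I)
    {X : TangentSpace 𝓘(ℝ, E₁) (α t)} {V : TangentSpace 𝓘(ℝ, E₂) (F (α t))}
    {Z : ∀ y : N, TangentSpace 𝓘(ℝ, E₂) y}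
    (hV : V ∈ (rangeAt (E₁ := E₁) (E₂ := E₂) F (α t))ᗮ)
    (hvel : velocity (E := E₂) (F ∘ α) t = push F (α t) X + V)
    (hZ : SmoothFieldAt Z (F (α t)))
    (hZT : ∀ᶠ τ in 𝓝 t, Z (F (α τ)) = velTang (E₁ := E₁) F α τ) :
    inner ℝ (shapeOp F (α t) (J (F (α t)) (push F (α t) X)) X +
          shapeOp F (α t) (normPart (E₁ := E₁) F (α t) (J (F (α t)) V)) X)
        (tangPart (E₁ := E₁) F (α t) (J (F (α t)) V))
      - inner ℝ (secondFF F (α t) X (ContinuousLinearMap.adjoint (push F (α t))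
            (tangPart (E₁ := E₁) F (α t) (J (F (α t)) V)))
          + normCov (E₁ := E₁) F (α t) (fun y ↦ J y (Z y)) (push F (α t) X)
          + normCov (E₁ := E₁) F (α t) (fun y ↦ J y (Z y)) V)
        (normPart (E₁ := E₁) F (α t) (J (F (α t)) V)) =
      -inner ℝ (covAlong (F ∘ α) (velTang (E₁ := E₁) (E₂ := E₂) F α) t (1 : ℝ))
        (velTang (E₁ := E₁) (E₂ := E₂) F α t) := by
  have hdβ : MDifferentiableAt 𝓘(ℝ, ℝ) 𝓘(ℝ, E₂) (F ∘ α) t :=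
    (hβ.1.contMDiffAt (hI.mem_nhds ht)).mdifferentiableAt (by simp)
  have hBm := tangPart_mem (E₁ := E₁) (F := F) (p := α t) (J (F (α t)) V)
  have hCm := normPart_mem (E₁ := E₁) (F := F) (p := α t) (J (F (α t)) V)
  have hT0 : velTang (E₁ := E₁) (E₂ := E₂) F α t = push F (α t) X := by
    rw [velTang, hvel]
    exact tangPart_add_of_mem ⟨X, rfl⟩ hV
  have hZ0 : Z (F (α t)) = push F (α t) X := hZT.self_of_nhds.trans hT0
  have hZd : DiffAlong (E' := ℝ) (F ∘ α) (fun τ ↦ Z (F (α τ))) t :=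
    hZ.diffAlong (f := F ∘ α) hdβ
  have hTd : DiffAlong (E' := ℝ) (F ∘ α) (velTang (E₁ := E₁) (E₂ := E₂) F α) t :=
    hZd.congr (hZT.mono fun _ h ↦ h.symm)
  have hvelT := inner_covAlong_velTang hI hβ ht hTd
  have hcov : leviCivita Z (F (α t)) (velocity (E := E₂) (F ∘ α) t) =
      covAlong (F ∘ α) (velTang (E₁ := E₁) (E₂ := E₂) F α) t (1 : ℝ) :=
    (covAlong_comp (f := F ∘ α) hZ hdβ (1 : ℝ)).symm.trans (covAlong_congr hZT _)
  have hA := inner_shapeOp_velTang hJ hF hanti hDF hD hgeod hdβ hV hBm hvel hZ hZ0 hZT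
  have hS := inner_shapeOp_eq_inner_secondFF hF hDF (hD (α t)) X hCm hBm
  have hC : inner ℝ (normCov (E₁ := E₁) F (α t) (fun y ↦ J y (Z y)) (push F (α t) X))
        (normPart (E₁ := E₁) F (α t) (J (F (α t)) V)) +
      inner ℝ (normCov (E₁ := E₁) F (α t) (fun y ↦ J y (Z y)) V)
        (normPart (E₁ := E₁) F (α t) (J (F (α t)) V)) =
      inner ℝ (leviCivita (fun y ↦ J y (Z y)) (F (α t)) (velocity (E := E₂) (F ∘ α) t))
        (normPart (E₁ := E₁) F (α t) (J (F (α t)) V)) := by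
    rw [normCov, normCov, inner_normPart hCm, inner_normPart hCm, ← inner_add_left,
      ← leviCivita_add, hvel]
  have hsum : inner ℝ (leviCivita (fun y ↦ J y (Z y)) (F (α t)) (velocity (E := E₂) (F ∘ α) t))
        (tangPart (E₁ := E₁) F (α t) (J (F (α t)) V)) +
      inner ℝ (leviCivita (fun y ↦ J y (Z y)) (F (α t)) (velocity (E := E₂) (F ∘ α) t))
        (normPart (E₁ := E₁) F (α t) (J (F (α t)) V)) =
      inner ℝ (covAlong (F ∘ α) (velTang (E₁ := E₁) (E₂ := E₂) F α) t (1 : ℝ)) V := by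
    -- BV + CV = JV, and J is parallel and isometric.
    rw [← inner_add_right, normPart_eq, add_sub_cancel, hJ.parallel Z _ _ hZ, hJ.isometry, hcov]
  have hVT : inner ℝ (covAlong (F ∘ α) (velTang (E₁ := E₁) (E₂ := E₂) F α) t (1 : ℝ)) V =
      inner ℝ (covAlong (F ∘ α) (velTang (E₁ := E₁) (E₂ := E₂) F α) t (1 : ℝ))
        (velTang (E₁ := E₁) (E₂ := E₂) F α t) := by
    rw [hvel] at hvelT
    have hadd := inner_add_right (𝕜 := ℝ)
      (covAlong (F ∘ α) (velTang (E₁ := E₁) (E₂ := E₂) F α) t (1 : ℝ)) (push F (α t) X) V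
    rw [hT0] at hvelT ⊢
    have hsolve : ∀ a b c : ℝ, c = 2 * a → c = a + b → b = a := fun a b c h h' ↦ by linarith
    exact hsolve _ _ _ hvelT hadd
  rw [inner_add_left, inner_add_left, inner_add_left]
  linarith

end Expression

end Clairaut

/-! ### From the Clairaut relation to the differential equation. -/

section Clairaut

variable {E₁ : Type*} [NormedAddCommGroup E₁] [NormedSpace ℝ E₁] [FiniteDimensional ℝ E₁]
  {M : Type*} [TopologicalSpace M] [ChartedSpace E₁ M] [IsManifold 𝓘(ℝ, E₁) ∞ M]
  [RiemannianBundle (fun x : M ↦ TangentSpace 𝓘(ℝ, E₁) x)]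
  {E₂ : Type*} [NormedAddCommGroup E₂] [NormedSpace ℝ E₂] [FiniteDimensional ℝ E₂]
  {N : Type*} [TopologicalSpace N] [ChartedSpace E₂ N] [IsManifold 𝓘(ℝ, E₂) ∞ N]
  [RiemannianBundle (fun x : N ↦ TangentSpace 𝓘(ℝ, E₂) x)]
  [IsContMDiffRiemannianBundle 𝓘(ℝ, E₂) ∞ E₂ (fun y : N ↦ TangentSpace 𝓘(ℝ, E₂) y)]
  {J : ∀ y : N, TangentSpace 𝓘(ℝ, E₂) y →L[ℝ] TangentSpace 𝓘(ℝ, E₂) y}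
  {F : M → N} {α : ℝ → M} {I : Set ℝ} {t : ℝ} {g : N → ℝ}

/-- A geodesic has constant speed. -/
lemma IsGeodesicOn.norm_velocity_eq {β : ℝ → N} (hI : IsOpen I) (hIc : IsPreconnected I)
    (hβ : IsGeodesicOn (E := E₂) β I) {s t : ℝ} (hs : s ∈ I) (ht : t ∈ I) :
    ‖velocity (E := E₂) β s‖ = ‖velocity (E := E₂) β t‖ := by
  have hd : ∀ τ ∈ I, HasDerivAt (fun τ ↦ inner ℝ (velocity (E := E₂) β τ)
      (velocity (E := E₂) β τ)) 0 τ := by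
    intro τ hτ
    have hv := diffAlong_velocity hI hβ.1 hτ
    have h := hasDerivAt_inner_along hv hv
    rwa [hβ.2 τ hτ, inner_zero_left, inner_zero_right, add_zero] at h
  have h := hI.is_const_of_deriv_eq_zero hIc
    (fun τ hτ ↦ (hd τ hτ).differentiableAt.differentiableWithinAt)
    (fun τ hτ ↦ (hd τ hτ).deriv) hs ht
  simp only [real_inner_self_eq_norm_sq] at h
  exact (sq_eq_sq₀ (norm_nonneg _) (norm_nonneg _)).1 h

lemma sin_angle_velocity_normPart (h : velocity (E := E₂) (F ∘ α) t ≠ 0) :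
    Real.sin (InnerProductGeometry.angle (velocity (E := E₂) (F ∘ α) t)
      (normPart (E₁ := E₁) F (α t) (velocity (E := E₂) (F ∘ α) t))) =
      ‖velTang (E₁ := E₁) (E₂ := E₂) F α t‖ / ‖velocity (E := E₂) (F ∘ α) t‖ := by
  have hsum : normPart (E₁ := E₁) F (α t) (velocity (E := E₂) (F ∘ α) t) +
      tangPart (E₁ := E₁) F (α t) (velocity (E := E₂) (F ∘ α) t) =
      velocity (E := E₂) (F ∘ α) t := by
    rw [normPart_eq, sub_add_cancel]
  have horth : inner ℝ (normPart (E₁ := E₁) F (α t) (velocity (E := E₂) (F ∘ α) t))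
      (tangPart (E₁ := E₁) F (α t) (velocity (E := E₂) (F ∘ α) t)) = 0 :=
    Submodule.inner_left_of_mem_orthogonal (tangPart_mem _) (normPart_mem _)
  have hne : normPart (E₁ := E₁) F (α t) (velocity (E := E₂) (F ∘ α) t) ≠ 0 ∨
      tangPart (E₁ := E₁) F (α t) (velocity (E := E₂) (F ∘ α) t) ≠ 0 := by
    by_contra hc
    push Not at hc
    rw [hc.1, hc.2, add_zero] at hsum
    exact h hsum.symm
  have hsin := InnerProductGeometry.sin_angle_add_of_inner_eq_zero horth hne
  rw [InnerProductGeometry.angle_comm, hsum] at hsin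
  exact hsin

section Distribution

variable {D : ∀ y : N, Submodule ℝ (TangentSpace 𝓘(ℝ, E₂) y)}

/-- Extend the velocity to a field on N and project it to D. -/
lemma exists_smoothFieldAt_velTang
    (hDF : ∀ p, D (F p) = rangeAt (E₁ := E₁) (E₂ := E₂) F p)
    (hD : ∀ p, ∀ Y : ∀ y : N, TangentSpace 𝓘(ℝ, E₂) y, SmoothFieldAt Y (F p) →
      SmoothFieldAt (fun z ↦ (D z).starProjection (Y z)) (F p))
    (hI : IsOpen I) (hβ : IsGeodesicOn (E := E₂) (F ∘ α) I) (ht : t ∈ I)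
    (h0 : velocity (E := E₂) (F ∘ α) t ≠ 0) :
    ∃ Z : ∀ y : N, TangentSpace 𝓘(ℝ, E₂) y, SmoothFieldAt Z (F (α t)) ∧
      ∀ᶠ τ in 𝓝 t, Z (F (α τ)) = velTang (E₁ := E₁) F α τ := by
  obtain ⟨W, hW, hWβ⟩ := exists_smoothFieldAt_velocity hI hβ.1 ht h0
  refine ⟨_, hD (α t) W hW, ?_⟩
  filter_upwards [hWβ] with τ hτ
  rw [starProjection_eq_tangPart (hDF (α τ))]
  exact congrArg _ hτ

lemma clairautEquationAt_iff (hJ : IsKaehler J)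
    (hF : IsRiemannianMap (E₁ := E₁) (E₂ := E₂) F)
    (hanti : IsAntiInvariant (E₁ := E₁) F J)
    (hDF : ∀ p, D (F p) = rangeAt (E₁ := E₁) (E₂ := E₂) F p)
    (hD : ∀ p, ∀ Y : ∀ y : N, TangentSpace 𝓘(ℝ, E₂) y, SmoothFieldAt Y (F p) →
      SmoothFieldAt (fun z ↦ (D z).starProjection (Y z)) (F p))
    (hgeod : ∀ p, ∀ u ∈ (D (F p))ᗮ, ∀ V : ∀ y : N, TangentSpace 𝓘(ℝ, E₂) y,
      SmoothFieldAt V (F p) → (∀ᶠ z in 𝓝 (F p), V z ∈ (D z)ᗮ) →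
      leviCivita V (F p) u ∈ (D (F p))ᗮ)
    (hI : IsOpen I) (hβ : IsGeodesicOn (E := E₂) (F ∘ α) I) (ht : t ∈ I)
    (h0 : velocity (E := E₂) (F ∘ α) t ≠ 0) :
    ClairautEquationAt (E₁ := E₁) F J g α t ↔
      inner ℝ (covAlong (F ∘ α) (velTang (E₁ := E₁) (E₂ := E₂) F α) t (1 : ℝ))
        (velTang (E₁ := E₁) (E₂ := E₂) F α t) +
      inner ℝ (velTang (E₁ := E₁) (E₂ := E₂) F α t) (velTang (E₁ := E₁) (E₂ := E₂) F α t) *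
        deriv (fun τ ↦ g (F (α τ))) t = 0 := by
  have hTX : ∀ (X : TangentSpace 𝓘(ℝ, E₁) (α t)) (V : TangentSpace 𝓘(ℝ, E₂) (F (α t))),
      V ∈ (rangeAt (E₁ := E₁) (E₂ := E₂) F (α t))ᗮ →
      velocity (E := E₂) (F ∘ α) t = push F (α t) X + V →
      velTang (E₁ := E₁) (E₂ := E₂) F α t = push F (α t) X := by
    intro X V hV hvel
    rw [velTang, hvel]
    exact tangPart_add_of_mem ⟨X, rfl⟩ hV
  constructor
  · intro h
    -- Since (∗) is quantified over all extensions, one must exist for it to carry information.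
    obtain ⟨Z, hZ, hZT⟩ := exists_smoothFieldAt_velTang hDF hD hI hβ ht h0
    obtain ⟨X, hX, hpush⟩ : ∃ X ∈ (kerAt (E₁ := E₁) (E₂ := E₂) F (α t))ᗮ,
        push F (α t) X = tangPart (E₁ := E₁) F (α t) (velocity (E := E₂) (F ∘ α) t) :=
      ⟨_, adjoint_push_mem (α t) _, hF.push_adjoint_push (tangPart_mem _)⟩
    have hVm := normPart_mem (E₁ := E₁) (F := F) (p := α t) (velocity (E := E₂) (F ∘ α) t)
    have hvel : velocity (E := E₂) (F ∘ α) t = push F (α t) X +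
        normPart (E₁ := E₁) F (α t) (velocity (E := E₂) (F ∘ α) t) := by
      rw [hpush, normPart_eq, add_sub_cancel]
    have h1 := h X _ Z hX hVm hvel hZ hZT
    have h2 := clairaut_expression_eq hJ hF hanti hDF hD hgeod hI hβ ht hVm hvel hZ hZT
    have h3 := hTX _ _ hVm hvel
    dsimp only at h1
    rw [h2, ← h3] at h1
    linarith
  · intro h X V Z _ hV hvel hZ hZT
    have h2 := clairaut_expression_eq hJ hF hanti hDF hD hgeod hI hβ ht hV hvel hZ hZT
    have h3 := hTX _ _ hV hvel
    dsimp only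
    rw [h2, ← h3]
    linarith

end Distribution

/-- At a point where the velocity vanishes, the equation holds trivially. -/
lemma clairautEquationAt_of_velocity_eq_zero
    (h0 : velocity (E := E₂) (F ∘ α) t = 0) : ClairautEquationAt (E₁ := E₁) F J g α t := by
  intro X V Z _ hV hvel _ _
  have hFX : push (E₂ := E₂) F (α t) X = 0 := by
    have h := tangPart_add_of_mem (E₁ := E₁) (F := F) ⟨X, rfl⟩ hV
    exact (h.symm.trans (congrArg _ (hvel.symm.trans h0))).trans (map_zero _)
  have hV0 : V = 0 := by
    have h : (0 : TangentSpace 𝓘(ℝ, E₂) (F (α t))) = push F (α t) X + V := h0.symm.trans hvel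
    rwa [hFX, zero_add, eq_comm] at h
  subst hV0
  dsimp only
  rw [hFX]
  simp only [map_zero, inner_zero_right, zero_mul, sub_zero]

lemma differentiableAt_comp_geodesic (hg : ContMDiff 𝓘(ℝ, E₂) 𝓘(ℝ, ℝ) ∞ g) (hI : IsOpen I)
    (hβ : IsGeodesicOn (E := E₂) (F ∘ α) I) (ht : t ∈ I) :
    DifferentiableAt ℝ (fun τ ↦ g (F (α τ))) t :=
  (hg.contMDiffAt.comp t (hβ.1.contMDiffAt (hI.mem_nhds ht))).contDiffAt.differentiableAt (by simp)

/-- The Clairaut relation along a geodesic `F ∘ α` is equivalent to the Clairaut equation. -/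
theorem clairautRelation_iff (hJ : IsKaehler J)
    (hF : IsRiemannianMap (E₁ := E₁) (E₂ := E₂) F)
    (hanti : IsAntiInvariant (E₁ := E₁) F J)
    (hgeod : HasTotallyGeodesicNormal (E₁ := E₁) (E₂ := E₂) F)
    (hg : ContMDiff 𝓘(ℝ, E₂) 𝓘(ℝ, ℝ) ∞ g)
    (hI : IsOpen I) (hIc : IsPreconnected I) (hβ : IsGeodesicOn (E := E₂) (F ∘ α) I) :
    ClairautRelation (E₁ := E₁) (E₂ := E₂) F (fun y ↦ Real.exp (g y)) α I ↔
      ∀ t ∈ I, ClairautEquationAt (E₁ := E₁) F J g α t := by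
  obtain ⟨U, D, hU, hUD, hDU, hgU⟩ := hgeod
  have hDF := fun p ↦ (hUD p).2
  have hD := fun p Y ↦ hDU Y (F p) (hUD p).1
  have hgD := fun p ↦ hgU (F p) (hUD p).1
  -- Constant speed leaves two cases: the velocity vanishes everywhere or nowhere on I.
  by_cases h0 : ∀ t ∈ I, velocity (E := E₂) (F ∘ α) t = 0
  · refine iff_of_true ?_ fun t ht ↦ clairautEquationAt_of_velocity_eq_zero (h0 t ht)
    have hgd : ∀ τ ∈ I, HasDerivAt (fun τ ↦ g (F (α τ))) 0 τ := by
      intro τ hτ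
      have hdβ := (hβ.1.contMDiffAt (hI.mem_nhds hτ)).mdifferentiableAt (by simp)
      have hd := (differentiableAt_comp_geodesic hg hI hβ hτ).hasDerivAt
      have hcomp := ((hg.mdifferentiableAt (x := (F ∘ α) τ) (by simp)).hasMFDerivAt.comp τ
        hdβ.hasMFDerivAt).mfderiv
      have happ := DFunLike.congr_fun hcomp (1 : ℝ)
      have hzero : deriv (fun τ ↦ g (F (α τ))) τ = 0 := by
        rw [← fderiv_apply_one_eq_deriv, ← mfderiv_eq_fderiv]
        exact happ.trans ((congrArg (mfderiv 𝓘(ℝ, E₂) 𝓘(ℝ, ℝ) g ((F ∘ α) τ)) (h0 τ hτ)).trans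
          (map_zero (mfderiv 𝓘(ℝ, E₂) 𝓘(ℝ, ℝ) g ((F ∘ α) τ))))
      rwa [hzero] at hd
    intro t₁ h₁ t₂ h₂
    have hconst : g (F (α t₁)) = g (F (α t₂)) := hI.is_const_of_deriv_eq_zero hIc
      (fun τ hτ ↦ (hgd τ hτ).differentiableAt.differentiableWithinAt)
      (fun τ hτ ↦ (hgd τ hτ).deriv) h₁ h₂
    -- The angle with the zero vector is π/2 at all times, so only e^g matters, and g∘β is constant.
    simp only [h0 t₁ h₁, h0 t₂ h₂, InnerProductGeometry.angle_zero_left, hconst]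
  · have hne : ∀ t ∈ I, velocity (E := E₂) (F ∘ α) t ≠ 0 := by
      push Not at h0
      obtain ⟨s, hs, hs0⟩ := h0
      intro t ht
      rw [← norm_ne_zero_iff] at hs0 ⊢
      rwa [hβ.norm_velocity_eq hI hIc ht hs]
    have hd : ∀ t ∈ I, HasDerivAt (fun τ ↦ Real.exp (2 * g (F (α τ))) *
        inner ℝ (velTang (E₁ := E₁) (E₂ := E₂) F α τ) (velTang (E₁ := E₁) (E₂ := E₂) F α τ))
        (2 * Real.exp (2 * g (F (α t))) *
          (inner ℝ (covAlong (F ∘ α) (velTang (E₁ := E₁) (E₂ := E₂) F α) t (1 : ℝ))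
            (velTang (E₁ := E₁) (E₂ := E₂) F α t) +
          inner ℝ (velTang (E₁ := E₁) (E₂ := E₂) F α t)
            (velTang (E₁ := E₁) (E₂ := E₂) F α t) * deriv (fun τ ↦ g (F (α τ))) t)) t := by
      intro t ht
      obtain ⟨Z, hZ, hZT⟩ := exists_smoothFieldAt_velTang hDF hD hI hβ ht (hne t ht)
      have hdβ := (hβ.1.contMDiffAt (hI.mem_nhds ht)).mdifferentiableAt (by simp)
      have hTd : DiffAlong (E' := ℝ) (F ∘ α) (velTang (E₁ := E₁) (E₂ := E₂) F α) t :=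
        (hZ.diffAlong (f := F ∘ α) (p := t) hdβ).congr (hZT.mono fun _ h ↦ h.symm)
      have h1 := ((differentiableAt_comp_geodesic hg hI hβ ht).hasDerivAt.const_mul 2).exp.mul
        (hasDerivAt_inner_along hTd hTd)
      refine h1.congr_deriv ?_
      have hring : ∀ e d a b c : ℝ, b = c →
          e * (2 * d) * a + e * (c + b) = 2 * e * (c + a * d) := by
        rintro e d a b _ rfl
        ring
      exact hring _ _ _ _ _ (real_inner_comm _ _)
    -- Both sides are nonnegative, so the relation may be squared after cancelling the common speed;
    -- this replaces |T| by the differentiable |T|².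
    have hrel : ∀ t₁ ∈ I, ∀ t₂ ∈ I,
        (Real.exp (g (F (α t₁))) * Real.sin (InnerProductGeometry.angle
          (velocity (E := E₂) (F ∘ α) t₁)
          (normPart (E₁ := E₁) F (α t₁) (velocity (E := E₂) (F ∘ α) t₁))) =
        Real.exp (g (F (α t₂))) * Real.sin (InnerProductGeometry.angle
          (velocity (E := E₂) (F ∘ α) t₂)
          (normPart (E₁ := E₁) F (α t₂) (velocity (E := E₂) (F ∘ α) t₂)))) ↔
        Real.exp (2 * g (F (α t₁))) * inner ℝ (velTang (E₁ := E₁) (E₂ := E₂) F α t₁)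
          (velTang (E₁ := E₁) (E₂ := E₂) F α t₁) =
        Real.exp (2 * g (F (α t₂))) * inner ℝ (velTang (E₁ := E₁) (E₂ := E₂) F α t₂)
          (velTang (E₁ := E₁) (E₂ := E₂) F α t₂) := by
      intro t₁ h₁ t₂ h₂
      have hpos : 0 < ‖velocity (E := E₂) (F ∘ α) t₂‖ := norm_pos_iff.2 (hne t₂ h₂)
      rw [sin_angle_velocity_normPart (hne t₁ h₁), sin_angle_velocity_normPart (hne t₂ h₂),
        hβ.norm_velocity_eq hI hIc h₁ h₂, real_inner_self_eq_norm_sq, real_inner_self_eq_norm_sq,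
        two_mul, two_mul, Real.exp_add, Real.exp_add, ← sq, ← sq, ← mul_pow, ← mul_pow,
        sq_eq_sq₀ (by positivity) (by positivity), mul_div_assoc', mul_div_assoc',
        div_left_inj' hpos.ne']
    have hrel' : ClairautRelation (E₁ := E₁) (E₂ := E₂) F (fun y ↦ Real.exp (g y)) α I ↔
        ∀ t₁ ∈ I, ∀ t₂ ∈ I,
        Real.exp (2 * g (F (α t₁))) * inner ℝ (velTang (E₁ := E₁) (E₂ := E₂) F α t₁)
          (velTang (E₁ := E₁) (E₂ := E₂) F α t₁) =
        Real.exp (2 * g (F (α t₂))) * inner ℝ (velTang (E₁ := E₁) (E₂ := E₂) F α t₂)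
          (velTang (E₁ := E₁) (E₂ := E₂) F α t₂) :=
      forall₂_congr fun t₁ h₁ ↦ forall₂_congr fun t₂ h₂ ↦ hrel t₁ h₁ t₂ h₂
    rw [hrel']
    constructor
    · intro h t ht
      rw [clairautEquationAt_iff hJ hF hanti hDF hD hgD hI hβ ht (hne t ht)]
      have hc := (hasDerivAt_const t (Real.exp (2 * g (F (α t))) *
        inner ℝ (velTang (E₁ := E₁) (E₂ := E₂) F α t)
          (velTang (E₁ := E₁) (E₂ := E₂) F α t))).congr_of_eventuallyEq
        (f₁ := fun τ ↦ Real.exp (2 * g (F (α τ))) *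
        inner ℝ (velTang (E₁ := E₁) (E₂ := E₂) F α τ) (velTang (E₁ := E₁) (E₂ := E₂) F α τ))
        (by filter_upwards [hI.mem_nhds ht] with τ hτ using h τ hτ t ht)
      have hz := (hd t ht).unique hc
      exact (mul_eq_zero.1 hz).resolve_left (by positivity)
    · intro h t₁ h₁ t₂ h₂
      refine hI.is_const_of_deriv_eq_zero (f := fun τ ↦ Real.exp (2 * g (F (α τ))) *
        inner ℝ (velTang (E₁ := E₁) (E₂ := E₂) F α τ) (velTang (E₁ := E₁) (E₂ := E₂) F α τ)) hIc
        (fun τ hτ ↦ (hd τ hτ).differentiableAt.differentiableWithinAt) (fun τ hτ ↦ ?_) h₁ h₂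
      have hz := (clairautEquationAt_iff hJ hF hanti hDF hD hgD hI hβ hτ (hne τ hτ)).1 (h τ hτ)
      rw [(hd τ hτ).deriv, hz, mul_zero]
      rfl

end Clairaut

end RiemMap

theorem mainTheorem9
    {E₁ : Type*} [NormedAddCommGroup E₁] [NormedSpace ℝ E₁] [FiniteDimensional ℝ E₁]
    {M : Type*} [TopologicalSpace M] [ChartedSpace E₁ M] [IsManifold 𝓘(ℝ, E₁) ∞ M]
    [RiemannianBundle (fun x : M ↦ TangentSpace 𝓘(ℝ, E₁) x)]
    [IsContMDiffRiemannianBundle 𝓘(ℝ, E₁) ∞ E₁ (fun x : M ↦ TangentSpace 𝓘(ℝ, E₁) x)]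
    {E₂ : Type*} [NormedAddCommGroup E₂] [NormedSpace ℝ E₂] [FiniteDimensional ℝ E₂]
    {N : Type*} [TopologicalSpace N] [ChartedSpace E₂ N] [IsManifold 𝓘(ℝ, E₂) ∞ N]
    [RiemannianBundle (fun y : N ↦ TangentSpace 𝓘(ℝ, E₂) y)]
    [IsContMDiffRiemannianBundle 𝓘(ℝ, E₂) ∞ E₂ (fun y : N ↦ TangentSpace 𝓘(ℝ, E₂) y)]
    (J : ∀ y : N, TangentSpace 𝓘(ℝ, E₂) y →L[ℝ] TangentSpace 𝓘(ℝ, E₂) y)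
    (hJ : RiemMap.IsKaehler J)
    (F : M → N)
    (hF : RiemMap.IsRiemannianMap (E₁ := E₁) (E₂ := E₂) F)
    (hanti : RiemMap.IsAntiInvariant (E₁ := E₁) F J)
    (hgeod : RiemMap.HasTotallyGeodesicNormal (E₁ := E₁) (E₂ := E₂) F)
    (g : N → ℝ) (hg : ContMDiff 𝓘(ℝ, E₂) 𝓘(ℝ, ℝ) ∞ g) :
    (RiemMap.IsClairaut (E₁ := E₁) (E₂ := E₂) F (fun y ↦ Real.exp (g y)) ↔
      ∀ (I : Set ℝ) (α : ℝ → M), IsOpen I → IsPreconnected I →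
        RiemMap.IsGeodesicOn (E := E₂) (F ∘ α) I →
        ∀ t ∈ I, RiemMap.ClairautEquationAt (E₁ := E₁) F J g α t) ∧
    (∀ (I : Set ℝ) (α : ℝ → M), IsOpen I → IsPreconnected I →
      RiemMap.IsGeodesicOn (E := E₁) α I → RiemMap.IsGeodesicOn (E := E₂) (F ∘ α) I →
      (RiemMap.ClairautRelation (E₁ := E₁) (E₂ := E₂) F (fun y ↦ Real.exp (g y)) α I ↔
        ∀ t ∈ I, RiemMap.ClairautEquationAt (E₁ := E₁) F J g α t)) := by
  refine ⟨?_, fun I α hI hIc _ hβ ↦ RiemMap.clairautRelation_iff hJ hF hanti hgeod hg hI hIc hβ⟩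
  constructor
  · intro h I α hI hIc hβ
    exact (RiemMap.clairautRelation_iff hJ hF hanti hgeod hg hI hIc hβ).1 (h.2 I α hI hIc hβ)
  · intro h
    exact ⟨fun y ↦ Real.exp_pos _, fun I α hI hIc hβ ↦
      (RiemMap.clairautRelation_iff hJ hF hanti hgeod hg hI hIc hβ).2 (h I α hI hIc hβ)⟩
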